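/- Let $n>2$ be an integer and $\bar\eta>0$. Let $F={}_2F_1$ be the hypergeometric function, $C_k^{(\lambda)}$ the Gegenbauer polynomials, $\Omega_d=2\pi^{d/2}/\Gamma(d/2)$, and $E_k(\eta)=\tanh^k\frac{\eta}{2}\;F\left(k,1-\frac n2;k+\frac n2;\tanh^2\frac{\eta}{2}\right)$. For $0\le\eta<\bar\eta$ and an angle $\theta$ put $$u(\eta,\theta)=\frac{\Omega_{n-1}}{\Omega_n}\sum_{k=0}^\infty\left(\frac{2k}{n-2}+1\right)\frac{E_k(\eta)}{E_k(\bar\eta)}\,C_k^{(\frac{n-2}{2})}(\cos\theta)\,\sin^{n-2}\theta .$$ Here $\theta=\alpha_1-\bar\alpha_1$ is the angle at the centre $O$ of the ball $U$ of radius $\bar\eta$ in $\mathbb H^n$ between an interior point at distance $\eta$ from $O$ and a boundary point. Call $h(\eta,\theta)$ zonal harmonic if it is a continuous function on $U$ (that is, continuous on $[0,\bar\eta)\times[0,\pi]$ and independent of $\theta$ at $\eta=0$), is $C^2$ on $(0,\bar\eta)\times(0,\pi)$, and satisfies there $$\left[\frac{\partial^2}{\partial\eta^2}+\frac{n-1}{\tanh\eta}\frac{\partial}{\partial\eta}+\frac1{\sinh^2\eta}\left(\frac{\partial^2}{\partial\theta^2}+\frac{n-2}{\tan\theta}\frac{\partial}{\partial\theta}\right)\right]h=0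 .$$ Then $E_k(\bar\eta)\neq0$ for all $k$, the series converges absolutely, and: (a) $u$ is the solution of the Dirichlet problem on $U$ with boundary data $\delta(\theta)$, written as a density with respect to $d\theta$: $u(\eta,\theta)=h(\eta,\theta)\sin^{n-2}\theta$ on $[0,\bar\eta)\times[0,\pi]$ with $h$ zonal harmonic, and $\int_0^\pi u(\eta,\theta)\varphi(\theta)\,d\theta\to\varphi(0)$ as $\eta\uparrow\bar\eta$ for every continuous $\varphi$ on $[0,\pi]$; and $u$ is, on $[0,\bar\eta)\times[0,\pi]$, the only function with these two properties. (b) $u$ is the (angular) Poisson kernel of $U$: for every continuous $g$ on $[0,\pi]$ there is exactly one $v$, continuous on $[0,\bar\eta]\times[0,\pi]$ and zonal harmonic, with $v(\bar\eta,\theta)=g(\theta)$ for $\theta\in[0,\pi]$, and its values on the polar axis are $v(\eta,0)=\int_0^\pi u(\eta,\theta)g(\theta)\,d\theta$ for $0\le\eta<\bar\eta$. -/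

import Mathlib

open Set Filter Topology

noncomputable section

namespace HypBall

/-- Surface area `Ω_d = 2 π^(d/2) / Γ(d/2)` of the unit sphere of `ℝ^d`. -/
def surfaceArea (d : ℝ) : ℝ := 2 * Real.pi ^ (d / 2) / Real.Gamma (d / 2)

/-- The Gegenbauer polynomial `C_k^{(lam)}(x)`, through its three-term recurrence
`k C_k = 2 (k + lam - 1) x C_{k-1} - (k + 2 lam - 2) C_{k-2}`. -/
def gegenbauer (lam x : ℝ) : ℕ → ℝ
  | 0 => 1
  | 1 => 2 * lam * x
  | k + 2 => (2 * ((k : ℝ) + 1 + lam) * x * gegenbauer lam x (k + 1)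
      - ((k : ℝ) + 2 * lam) * gegenbauer lam x k) / ((k : ℝ) + 2)

/-- The radial function `tanh^k(η/2) F(k, 1 - n/2; k + n/2; tanh²(η/2))`. -/
def radial (n k : ℕ) (η : ℝ) : ℝ :=
  Real.tanh (η / 2) ^ k *
    ordinaryHypergeometric (k : ℝ) (1 - (n : ℝ) / 2) ((k : ℝ) + (n : ℝ) / 2)
      (Real.tanh (η / 2) ^ 2)

/-- The `k`-th summand of the kernel; `R` is the radius of the ball and `θ` the angle at the centre
between the interior point, at distance `η` from the centre, and the boundary point. -/
def kernelTerm (n : ℕ) (R η θ : ℝ) (k : ℕ) : ℝ :=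
  (2 * (k : ℝ) / ((n : ℝ) - 2) + 1) * (radial n k η / radial n k R) *
    gegenbauer (((n : ℝ) - 2) / 2) (Real.cos θ) k * Real.sin θ ^ (n - 2)

/-- The kernel `u(η, θ)` of the ball of radius `R`. -/
def kernel (n : ℕ) (R η θ : ℝ) : ℝ :=
  surfaceArea ((n : ℝ) - 1) / surfaceArea n * ∑' k : ℕ, kernelTerm n R η θ k

/-- The Laplace operator of hyperbolic `n`-space, in geodesic polar coordinates, on functions of the
distance `η` from the centre and of one polar angle `θ`. -/
def zonalLaplacian (n : ℕ) (h : ℝ → ℝ → ℝ) (η θ : ℝ) : ℝ :=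
  iteratedDeriv 2 (fun s => h s θ) η
    + ((n : ℝ) - 1) / Real.tanh η * deriv (fun s => h s θ) η
    + 1 / Real.sinh η ^ 2 *
      (iteratedDeriv 2 (fun t => h η t) θ
        + ((n : ℝ) - 2) * (Real.cos θ / Real.sin θ) * deriv (fun t => h η t) θ)

/-- `h` is a harmonic function on the open hyperbolic ball of radius `R`, depending only on the
distance `η` from the centre and on one polar angle `θ ∈ [0, π]`: it is a continuous function on the
ball (so that it has one value at the centre `η = 0`), and it is twice continuously differentiable
and solves the Laplace equation where the coordinates are regular. -/
structure IsZonalHarmonic (n : ℕ) (R : ℝ) (h : ℝ → ℝ → ℝ) : Prop where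
  contDiffOn : ContDiffOn ℝ 2 (Function.uncurry h) (Ioo 0 R ×ˢ Ioo 0 Real.pi)
  laplace : ∀ η ∈ Ioo 0 R, ∀ θ ∈ Ioo 0 Real.pi, zonalLaplacian n h η θ = 0
  continuousOn : ContinuousOn (Function.uncurry h) (Ico 0 R ×ˢ Icc 0 Real.pi)
  center : ∀ θ ∈ Icc 0 Real.pi, h 0 θ = h 0 0

/-- `v` solves the Dirichlet problem on the ball with the zonal boundary data `g`. -/
structure IsDirichletSolution (n : ℕ) (R : ℝ) (g : ℝ → ℝ) (v : ℝ → ℝ → ℝ) : Prop where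
  harmonic : IsZonalHarmonic n R v
  continuousOn : ContinuousOn (Function.uncurry v) (Icc 0 R ×ˢ Icc 0 Real.pi)
  boundary : ∀ θ ∈ Icc 0 Real.pi, v R θ = g θ

/-- `u` solves the Dirichlet problem on the ball with the delta boundary data `δ(θ)`. As the datum
is a delta with respect to `dθ`, the solution is written as a density with respect to `dθ` too:
`u(η, θ) = h(η, θ) sin^(n-2) θ`, with `h` harmonic and `sin^(n-2) θ dθ` the angular part of the
surface measure; the boundary values are taken in the weak sense. -/
def IsDeltaSolution (n : ℕ) (R : ℝ) (u : ℝ → ℝ → ℝ) : Prop :=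
  (∃ h : ℝ → ℝ → ℝ, IsZonalHarmonic n R h ∧
    ∀ η ∈ Ico 0 R, ∀ θ ∈ Icc 0 Real.pi, u η θ = h η θ * Real.sin θ ^ (n - 2)) ∧
  ∀ φ : ℝ → ℝ, ContinuousOn φ (Icc 0 Real.pi) →
    Tendsto (fun η => ∫ θ in (0 : ℝ)..Real.pi, u η θ * φ θ) (𝓝[<] R) (𝓝 (φ 0))

end HypBall

end

noncomputable section

namespace HypBall

/-! ### Gegenbauer polynomials -/

/-! Write n = m + 2, Z_k(θ) = C_k^{(m/2)}(cos θ), and E_k for the radial functions. Separation of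
variables in geodesic polar coordinates produces the harmonic functions E_k(η) Z_k(θ): Z_k is an
eigenfunction of the angular operator for -k(k+m) (`zonal_ode`), and the radial equation for this
eigenvalue turns into the hypergeometric equation in tanh²(η/2) (`hasDerivAt_radialDeriv`). The Z_k
are orthogonal for the weight sin^m θ, and the numerical factors of the kernel are exactly
Z_k(0)/‖Z_k‖² (`kernelCoeff_mul_zonalNormSq`). So the kernel is the formal zonal expansion of the
delta at θ = 0, carried inside by the factors E_k(η)/E_k(R).

Convergence comes from the radial equation. An energy argument gives E_k > 0 (`radial_pos`);
comparing E_k with the power tanh(η/2)^(k / cosh R) shows that E_k(η)/E_k(R) decays geometrically in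
k on smaller balls (`exists_radial_div_le`). Since everything angular grows only polynomially in k,
the series may be differentiated termwise (`zonalSeries_differential`).

Boundary values come from the maximum principle `le_of_boundary_le`, in which a superharmonic
barrier makes the centre and the polar axis negligible. Finite sums of the Z_k are solved
explicitly; they are uniformly dense by Weierstrass, and the maximum principle passes to the limit
(`isDirichletSolution_dirichletExtension`). Positivity of the kernel is not needed. Integrating a
datum against the kernel gives termwise the value of its solution on the axis
(`integral_kernel_mul`), which yields both the Poisson formula and the weak limit to the delta.

Uniqueness for the delta datum: the k-th zonal coefficient of a harmonic function on the sphere of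
radius η is proportional to E_k(η). If it tends to 0 as η ↑ R, it vanishes because E_k(R) > 0, and
then so does the function (`IsZonalHarmonic.eq_zero`). -/

/-- The derivative of `gegenbauer lam · k`. -/
def gegenbauerDeriv (lam x : ℝ) : ℕ → ℝ
  | 0 => 0
  | 1 => 2 * lam
  | k + 2 => (2 * ((k : ℝ) + 1 + lam)
        * (gegenbauer lam x (k + 1) + x * gegenbauerDeriv lam x (k + 1))
      - ((k : ℝ) + 2 * lam) * gegenbauerDeriv lam x k) / ((k : ℝ) + 2)

theorem gegenbauer_recurrence (lam x : ℝ) (k : ℕ) :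
    ((k : ℝ) + 2) * gegenbauer lam x (k + 2) =
      2 * ((k : ℝ) + 1 + lam) * x * gegenbauer lam x (k + 1)
        - ((k : ℝ) + 2 * lam) * gegenbauer lam x k := by
  rw [gegenbauer]; field_simp

theorem gegenbauerDeriv_recurrence (lam x : ℝ) (k : ℕ) :
    ((k : ℝ) + 2) * gegenbauerDeriv lam x (k + 2) =
      2 * ((k : ℝ) + 1 + lam) * (gegenbauer lam x (k + 1) + x * gegenbauerDeriv lam x (k + 1))
      - ((k : ℝ) + 2 * lam) * gegenbauerDeriv lam x k := by
  rw [gegenbauerDeriv]; field_simp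

theorem hasDerivAt_gegenbauer (lam x : ℝ) (k : ℕ) :
    HasDerivAt (fun y => gegenbauer lam y k) (gegenbauerDeriv lam x k) x := by
  induction k using Nat.twoStepInduction with
  | zero => simpa [gegenbauer, gegenbauerDeriv] using hasDerivAt_const x (1 : ℝ)
  | one => simpa [gegenbauer, gegenbauerDeriv] using (hasDerivAt_id x).const_mul (2 * lam)
  | more k h0 h1 =>
    have h := ((((hasDerivAt_id x).const_mul (2 * ((k : ℝ) + 1 + lam))).mul h1).sub
      (h0.const_mul ((k : ℝ) + 2 * lam))).div_const ((k : ℝ) + 2)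
    simp only [gegenbauer, gegenbauerDeriv]
    refine h.congr_deriv ?_
    simp only [id]; ring

theorem differentiable_gegenbauerDeriv (lam : ℝ) (k : ℕ) :
    Differentiable ℝ (fun y => gegenbauerDeriv lam y k) := by
  have hC : ∀ k, Differentiable ℝ (fun y => gegenbauer lam y k) :=
    fun k x => (hasDerivAt_gegenbauer lam x k).differentiableAt
  induction k using Nat.twoStepInduction with
  | zero => simp [gegenbauerDeriv]
  | one => simp [gegenbauerDeriv]
  | more k h0 h1 =>
    simp only [gegenbauerDeriv]
    have := hC (k + 1)
    fun_prop

/-- The two relations are proved together, as neither is inductive alone: the second at k + 1 needs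
the first at k, and the first at k + 1 needs the new second one and both old ones. The differential
equation and the value at x = 1 follow from them. -/
theorem gegenbauerDeriv_relations (lam x : ℝ) (k : ℕ) :
    x * gegenbauerDeriv lam x (k + 1) - gegenbauerDeriv lam x k
        = ((k : ℝ) + 1) * gegenbauer lam x (k + 1) ∧
      gegenbauerDeriv lam x (k + 1) - x * gegenbauerDeriv lam x k
        = ((k : ℝ) + 2 * lam) * gegenbauer lam x k := by
  induction k with
  | zero =>
    refine ⟨?_, by simp [gegenbauer, gegenbauerDeriv]⟩
    simp [gegenbauer, gegenbauerDeriv]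
    ring
  | succ k ih =>
    obtain ⟨hA, hB⟩ := ih
    have hC := gegenbauer_recurrence lam x k
    have hD := gegenbauerDeriv_recurrence lam x k
    have hk : (k : ℝ) + 2 ≠ 0 := by positivity
    have hB' : gegenbauerDeriv lam x (k + 2) - x * gegenbauerDeriv lam x (k + 1)
        = ((k : ℝ) + 1 + 2 * lam) * gegenbauer lam x (k + 1) := by
      apply mul_left_cancel₀ hk
      linear_combination hD + ((k : ℝ) + 2 * lam) * hA
    push_cast
    refine ⟨?_, hB'⟩
    linear_combination x * hB' - hC + x * hA - hB

theorem one_sub_sq_mul_gegenbauerDeriv (lam x : ℝ) (k : ℕ) :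
    (1 - x ^ 2) * gegenbauerDeriv lam x (k + 1) =
      ((k : ℝ) + 2 * lam) * gegenbauer lam x k - ((k : ℝ) + 1) * x * gegenbauer lam x (k + 1) := by
  obtain ⟨hA, hB⟩ := gegenbauerDeriv_relations lam x k
  linear_combination hB - x * hA

theorem gegenbauerDeriv_succ_succ (lam x : ℝ) (k : ℕ) :
    gegenbauerDeriv lam x (k + 2) =
      gegenbauerDeriv lam x k + 2 * ((k : ℝ) + 1 + lam) * gegenbauer lam x (k + 1) := by
  have hA := (gegenbauerDeriv_relations lam x k).1
  have hB := (gegenbauerDeriv_relations lam x (k + 1)).2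
  push_cast at hB
  linear_combination hB + hA

/-- The Gegenbauer differential equation. -/
theorem gegenbauer_ode (lam x : ℝ) (k : ℕ) :
    (1 - x ^ 2) * deriv (fun y => gegenbauerDeriv lam y k) x =
      (2 * lam + 1) * x * gegenbauerDeriv lam x k
        - (k : ℝ) * ((k : ℝ) + 2 * lam) * gegenbauer lam x k := by
  cases k with
  | zero => simp [gegenbauerDeriv]
  | succ k =>
    -- The same product is differentiated twice: by the product rule, and after replacing it by a
    -- first-order expression in the polynomials. Comparing the results gives the equation.
    have h1 : HasDerivAt (fun y => (1 - y ^ 2) * gegenbauerDeriv lam y (k + 1))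
        ((-(2 * x)) * gegenbauerDeriv lam x (k + 1)
          + (1 - x ^ 2) * deriv (fun y => gegenbauerDeriv lam y (k + 1)) x) x := by
      have := (((hasDerivAt_pow 2 x).const_sub 1)).mul
        (differentiable_gegenbauerDeriv lam (k + 1) x).hasDerivAt
      refine this.congr_deriv ?_
      simp
    have h2 : HasDerivAt (fun y => (1 - y ^ 2) * gegenbauerDeriv lam y (k + 1))
        (((k : ℝ) + 2 * lam) * gegenbauerDeriv lam x k
          - (((k : ℝ) + 1) * gegenbauer lam x (k + 1)
            + ((k : ℝ) + 1) * x * gegenbauerDeriv lam x (k + 1))) x := by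
      simp_rw [one_sub_sq_mul_gegenbauerDeriv]
      have := ((hasDerivAt_gegenbauer lam x k).const_mul ((k : ℝ) + 2 * lam)).sub
        (((hasDerivAt_id x).const_mul ((k : ℝ) + 1)).mul (hasDerivAt_gegenbauer lam x (k + 1)))
      refine this.congr_deriv ?_
      simp
    have h := h1.unique h2
    have hA := (gegenbauerDeriv_relations lam x k).1
    push_cast
    linear_combination h - ((k : ℝ) + 2 * lam) * hA

theorem gegenbauer_neg (lam x : ℝ) (k : ℕ) :
    gegenbauer lam (-x) k = (-1) ^ k * gegenbauer lam x k := by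
  induction k using Nat.twoStepInduction with
  | zero => simp [gegenbauer]
  | one => simp [gegenbauer]
  | more k h0 h1 => simp only [gegenbauer, h0, h1]; ring

theorem gegenbauer_one_succ (lam : ℝ) (k : ℕ) :
    ((k : ℝ) + 1) * gegenbauer lam 1 (k + 1) = ((k : ℝ) + 2 * lam) * gegenbauer lam 1 k := by
  have := one_sub_sq_mul_gegenbauerDeriv lam 1 k
  linarith

theorem gegenbauer_one_pos {lam : ℝ} (hlam : 0 < lam) (k : ℕ) : 0 < gegenbauer lam 1 k := by
  induction k with
  | zero => simp [gegenbauer]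
  | succ k ih =>
    have h := gegenbauer_one_succ lam k
    have : 0 < ((k : ℝ) + 1) * gegenbauer lam 1 (k + 1) := by rw [h]; positivity
    exact pos_of_mul_pos_right this (by positivity)

/-- Sonin's argument: the energy μ C² + (1 - x²) C'² has derivative 4 lam x C'² by the differential
equation, so on [0, 1] it is largest at 1, where the second summand vanishes. -/
theorem abs_gegenbauer_le_of_nonneg {lam : ℝ} (hlam : 0 < lam) (k : ℕ) {x : ℝ} (hx : x ∈ Icc 0 1) :
    |gegenbauer lam x k| ≤ gegenbauer lam 1 k := by
  rcases Nat.eq_zero_or_pos k with rfl | hk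
  · simp [gegenbauer]
  set μ : ℝ := (k : ℝ) * ((k : ℝ) + 2 * lam) with hμ
  have hk' : (0 : ℝ) < k := by exact_mod_cast hk
  have hμ0 : 0 < μ := by positivity
  let W : ℝ → ℝ := fun y => μ * gegenbauer lam y k ^ 2 + (1 - y ^ 2) * gegenbauerDeriv lam y k ^ 2
  have hW : ∀ y, HasDerivAt W (4 * lam * y * gegenbauerDeriv lam y k ^ 2) y := by
    intro y
    have h := (((hasDerivAt_gegenbauer lam y k).pow 2).const_mul μ).add
      (((hasDerivAt_pow 2 y).const_sub 1).mul
        ((differentiable_gegenbauerDeriv lam k y).hasDerivAt.pow 2))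
    refine h.congr_deriv ?_
    have := gegenbauer_ode lam y k
    simp only [Pi.pow_apply]
    push_cast
    linear_combination 2 * gegenbauerDeriv lam y k * this
  have hmono : MonotoneOn W (Icc 0 1) := by
    apply monotoneOn_of_deriv_nonneg (convex_Icc 0 1)
    · exact fun y _ => (hW y).continuousAt.continuousWithinAt
    · exact fun y _ => (hW y).differentiableAt.differentiableWithinAt
    · intro y hy
      rw [interior_Icc] at hy
      rw [(hW y).deriv]
      have := hy.1
      positivity
  have h := hmono hx (right_mem_Icc.2 zero_le_one) hx.2
  have h1 : μ * gegenbauer lam x k ^ 2 ≤ μ * gegenbauer lam 1 k ^ 2 := by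
    have : 0 ≤ (1 - x ^ 2) * gegenbauerDeriv lam x k ^ 2 := by
      have : 0 ≤ 1 - x ^ 2 := by nlinarith [hx.1, hx.2]
      positivity
    simp only [W] at h
    linarith
  exact abs_le_of_sq_le_sq (le_of_mul_le_mul_left h1 hμ0) (gegenbauer_one_pos hlam k).le

theorem abs_gegenbauer_le {lam : ℝ} (hlam : 0 < lam) (k : ℕ) {x : ℝ} (hx : x ∈ Icc (-1) 1) :
    |gegenbauer lam x k| ≤ gegenbauer lam 1 k := by
  rcases le_total 0 x with h | h
  · exact abs_gegenbauer_le_of_nonneg hlam k ⟨h, hx.2⟩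
  · have := abs_gegenbauer_le_of_nonneg hlam k (x := -x) ⟨by linarith, by linarith [hx.1]⟩
    rwa [gegenbauer_neg, abs_mul, abs_pow, abs_neg, abs_one, one_pow, one_mul] at this

/-- The ratio of consecutive values is 1 + (m - 1)/(k + 1), at most (1 + 1/(k + 1))^(m - 1) by
Bernoulli, and the product of these bounds telescopes. -/
theorem gegenbauer_one_le {m : ℕ} (hm : 0 < m) (k : ℕ) :
    gegenbauer ((m : ℝ) / 2) 1 k ≤ ((k : ℝ) + 1) ^ (m - 1) := by
  induction k with
  | zero => simp [gegenbauer]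
  | succ k ih =>
    have h := gegenbauer_one_succ ((m : ℝ) / 2) k
    have hk : (0 : ℝ) < (k : ℝ) + 1 := by positivity
    have hb := one_add_mul_le_pow (a := 1 / ((k : ℝ) + 1))
      (by have : 0 < 1 / ((k : ℝ) + 1) := by positivity
          linarith) (m - 1)
    have hm' : ((m - 1 : ℕ) : ℝ) = (m : ℝ) - 1 := by
      rw [Nat.cast_sub hm]; simp
    rw [hm'] at hb
    have e1 : gegenbauer ((m : ℝ) / 2) 1 (k + 1)
        = (1 + ((m : ℝ) - 1) * (1 / ((k : ℝ) + 1))) * gegenbauer ((m : ℝ) / 2) 1 k := by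
      field_simp
      linear_combination h
    have e2 : ((k + 1 : ℕ) : ℝ) + 1 = (1 + 1 / ((k : ℝ) + 1)) * ((k : ℝ) + 1) := by
      push_cast; field_simp
    rw [e1, e2, mul_pow]
    exact mul_le_mul hb ih (gegenbauer_one_pos (by positivity) k).le (by positivity)

theorem abs_gegenbauer_le_pow {m : ℕ} (hm : 0 < m) (k : ℕ) {x : ℝ} (hx : x ∈ Icc (-1) 1) :
    |gegenbauer ((m : ℝ) / 2) x k| ≤ ((k : ℝ) + 1) ^ (m - 1) :=
  (abs_gegenbauer_le (by positivity) k hx).trans (gegenbauer_one_le hm k)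

/-- The derivative of index k + 2 exceeds that of index k by a multiple, linear in k, of a
Gegenbauer polynomial; summing these increments costs two powers of k. -/
theorem abs_gegenbauerDeriv_le {m : ℕ} (hm : 0 < m) (k : ℕ) {x : ℝ} (hx : x ∈ Icc (-1) 1) :
    |gegenbauerDeriv ((m : ℝ) / 2) x k| ≤ ((k : ℝ) + m + 1) ^ 2 * ((k : ℝ) + 1) ^ (m - 1) := by
  induction k using Nat.twoStepInduction with
  | zero => simp [gegenbauerDeriv]; positivity
  | one =>
    simp only [gegenbauerDeriv]
    rw [abs_of_nonneg (by positivity)]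
    have h1 : (1 : ℝ) ≤ (((1 : ℕ) : ℝ) + 1) ^ (m - 1) := one_le_pow₀ (by norm_num)
    have hm' : (0 : ℝ) ≤ m := by positivity
    push_cast at *
    exact le_trans (by nlinarith) (le_mul_of_one_le_right (sq_nonneg (1 + (m : ℝ) + 1)) h1)
  | more k h0 h1 =>
    rw [gegenbauerDeriv_succ_succ]
    have hC := abs_gegenbauer_le_pow hm (k + 1) hx
    have p1 : ((k : ℝ) + 1) ^ (m - 1) ≤ ((k : ℝ) + 2 + 1) ^ (m - 1) := by gcongr; linarith
    have p2 : ((k : ℝ) + 1 + 1) ^ (m - 1) ≤ ((k : ℝ) + 2 + 1) ^ (m - 1) := by gcongr; linarith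
    push_cast at *
    calc _ ≤ |gegenbauerDeriv ((m : ℝ) / 2) x k|
          + |2 * ((k : ℝ) + 1 + m / 2) * gegenbauer (m / 2) x (k + 1)| := abs_add_le _ _
      _ ≤ ((k : ℝ) + m + 1) ^ 2 * ((k : ℝ) + 2 + 1) ^ (m - 1)
          + 2 * ((k : ℝ) + 1 + m / 2) * ((k : ℝ) + 2 + 1) ^ (m - 1) := by
        rw [abs_mul, abs_of_nonneg (by positivity : 0 ≤ 2 * ((k : ℝ) + 1 + m / 2))]
        gcongr
        · exact h0.trans (by gcongr)
        · exact hC.trans p2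
      _ = (((k : ℝ) + m + 1) ^ 2 + 2 * ((k : ℝ) + 1 + m / 2)) * ((k : ℝ) + 2 + 1) ^ (m - 1) := by
        ring
      _ ≤ _ := by
        gcongr
        nlinarith [(by positivity : (0 : ℝ) ≤ k), (by positivity : (0 : ℝ) ≤ m)]

/-- Polynomials are linear combinations of Gegenbauer polynomials. -/
theorem exists_eval_eq_sum_gegenbauer {lam : ℝ} (hlam : 0 < lam) (p : Polynomial ℝ) :
    ∃ c : ℕ →₀ ℝ, ∀ x, p.eval x = ∑ k ∈ c.support, c k * gegenbauer lam x k := by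
  let S : Submodule ℝ (ℝ → ℝ) := Submodule.span ℝ (range fun (k : ℕ) (x : ℝ) => gegenbauer lam x k)
  have hgen : ∀ k : ℕ, (fun x : ℝ => gegenbauer lam x k) ∈ S :=
    fun k => Submodule.subset_span ⟨k, rfl⟩
  -- The three-term recurrence, solved for x C_{k+1}, keeps the span stable under multiplication by
  -- x; so it contains all monomials.
  have hX : ∀ f ∈ S, (fun x => x * f x) ∈ S := by
    intro f hf
    induction hf using Submodule.span_induction with
    | mem f hf =>
      obtain ⟨k, rfl⟩ := hf
      cases k with
      | zero =>
        have : (fun x => x * gegenbauer lam x 0)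
            = (1 / (2 * lam)) • (fun x : ℝ => gegenbauer lam x 1) := by
          ext x; simp [gegenbauer]; field_simp
        simpa only [this] using S.smul_mem _ (hgen 1)
      | succ k =>
        have : (fun x => x * gegenbauer lam x (k + 1))
            = (1 / (2 * ((k : ℝ) + 1 + lam))) •
              (((k : ℝ) + 2) • (fun x : ℝ => gegenbauer lam x (k + 2))
                + ((k : ℝ) + 2 * lam) • (fun x : ℝ => gegenbauer lam x k)) := by
          ext x
          have h := gegenbauer_recurrence lam x k
          have : (k : ℝ) + 1 + lam ≠ 0 := by positivity
          simp only [Pi.smul_apply, Pi.add_apply, smul_eq_mul]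
          rw [h]; field_simp; ring
        simpa only [this] using
          S.smul_mem _ (S.add_mem (S.smul_mem _ (hgen _)) (S.smul_mem _ (hgen _)))
    | zero =>
      convert S.zero_mem using 1
      ext x; simp
    | add f g _ _ hf hg =>
      have := S.add_mem hf hg
      convert this using 1
      ext x; simp [mul_add]
    | smul a f _ hf =>
      have := S.smul_mem a hf
      convert this using 1
      ext x; simp; ring
  have hp : (fun x => p.eval x) ∈ S := by
    induction p using Polynomial.induction_on' with
    | add p q hp hq =>
      have := S.add_mem hp hq
      convert this using 1
      ext x; simp
    | monomial j a =>
      have hpow : (fun x : ℝ => x ^ j) ∈ S := by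
        induction j with
        | zero => simpa [gegenbauer] using hgen 0
        | succ j ih => simpa only [pow_succ'] using hX _ ih
      have := S.smul_mem a hpow
      convert this using 1
      ext x; simp
  obtain ⟨c, hc⟩ := Finsupp.mem_span_range_iff_exists_finsupp.1 hp
  refine ⟨c, fun x => ?_⟩
  have := congrFun hc x
  simp only [Finsupp.sum, Finset.sum_apply, Pi.smul_apply, smul_eq_mul] at this
  exact this.symm

/-! ### Zonal functions on the sphere -/

/-- The zonal function `C_k^{(m/2)}(cos θ)`. -/
def zonal (m k : ℕ) (θ : ℝ) : ℝ := gegenbauer ((m : ℝ) / 2) (Real.cos θ) k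

/-- The first derivative of `zonal m k`. -/
def zonalDeriv (m k : ℕ) (θ : ℝ) : ℝ :=
  -Real.sin θ * gegenbauerDeriv ((m : ℝ) / 2) (Real.cos θ) k

/-- The second derivative of `zonal m k`. -/
def zonalDerivTwo (m k : ℕ) (θ : ℝ) : ℝ :=
  m * Real.cos θ * gegenbauerDeriv ((m : ℝ) / 2) (Real.cos θ) k
    - (k : ℝ) * ((k : ℝ) + m) * zonal m k θ

theorem cos_mem_Icc (θ : ℝ) : Real.cos θ ∈ Icc (-1) 1 := ⟨Real.neg_one_le_cos θ, Real.cos_le_one θ⟩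

theorem hasDerivAt_zonal (m k : ℕ) (θ : ℝ) : HasDerivAt (zonal m k) (zonalDeriv m k θ) θ := by
  have := (hasDerivAt_gegenbauer ((m : ℝ) / 2) (Real.cos θ) k).comp θ (Real.hasDerivAt_cos θ)
  exact this.congr_deriv (mul_comm _ _)

theorem hasDerivAt_gegenbauerDeriv_cos (lam : ℝ) (k : ℕ) (θ : ℝ) :
    HasDerivAt (fun t => gegenbauerDeriv lam (Real.cos t) k)
      (deriv (fun y => gegenbauerDeriv lam y k) (Real.cos θ) * -Real.sin θ) θ :=
  (differentiable_gegenbauerDeriv lam k (Real.cos θ)).hasDerivAt.comp θ (Real.hasDerivAt_cos θ)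

/-- The second derivative of the polynomial is eliminated through the Gegenbauer equation, so that
later bounds need only its first derivative. -/
theorem hasDerivAt_zonalDeriv (m k : ℕ) (θ : ℝ) :
    HasDerivAt (zonalDeriv m k) (zonalDerivTwo m k θ) θ := by
  have := (Real.hasDerivAt_sin θ).neg.mul (hasDerivAt_gegenbauerDeriv_cos ((m : ℝ) / 2) k θ)
  refine this.congr_deriv ?_
  have h := gegenbauer_ode ((m : ℝ) / 2) (Real.cos θ) k
  have hs := Real.sin_sq_add_cos_sq θ
  simp only [Pi.neg_apply, zonalDerivTwo, zonal]
  linear_combination h + deriv (fun y => gegenbauerDeriv ((m : ℝ) / 2) y k) (Real.cos θ) * hs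

theorem continuous_zonal (m k : ℕ) : Continuous (zonal m k) :=
  continuous_iff_continuousAt.2 fun θ => (hasDerivAt_zonal m k θ).continuousAt

theorem continuous_zonalDerivTwo (m k : ℕ) : Continuous (zonalDerivTwo m k) := by
  have h1 : Continuous fun t => gegenbauerDeriv ((m : ℝ) / 2) (Real.cos t) k :=
    continuous_iff_continuousAt.2 fun θ => (hasDerivAt_gegenbauerDeriv_cos _ k θ).continuousAt
  have h2 := continuous_zonal m k
  unfold zonalDerivTwo
  fun_prop

theorem zonal_ode (m k : ℕ) {θ : ℝ} (hθ : Real.sin θ ≠ 0) :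
    zonalDerivTwo m k θ + m * (Real.cos θ / Real.sin θ) * zonalDeriv m k θ
      = -((k : ℝ) * ((k : ℝ) + m)) * zonal m k θ := by
  simp only [zonalDerivTwo, zonalDeriv]
  field_simp
  ring

theorem zonal_zero_left (m : ℕ) (θ : ℝ) : zonal m 0 θ = 1 := by simp [zonal, gegenbauer]

theorem abs_zonal_le {m : ℕ} (hm : 0 < m) (k : ℕ) (θ : ℝ) : |zonal m k θ| ≤ zonal m k 0 := by
  have := abs_gegenbauer_le (lam := (m : ℝ) / 2) (by positivity) k (cos_mem_Icc θ)
  simpa [zonal] using this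

theorem zonal_apply_zero_pos {m : ℕ} (hm : 0 < m) (k : ℕ) : 0 < zonal m k 0 := by
  simpa [zonal] using gegenbauer_one_pos (lam := (m : ℝ) / 2) (by positivity) k

theorem abs_gegenbauerDeriv_cos_le {m : ℕ} (hm : 0 < m) (k : ℕ) (θ : ℝ) :
    |gegenbauerDeriv ((m : ℝ) / 2) (Real.cos θ) k|
      ≤ ((m : ℝ) + 1) ^ 2 * ((k : ℝ) + 1) ^ (m + 1) := by
  obtain ⟨j, rfl⟩ : ∃ j, m = j + 1 := ⟨m - 1, by omega⟩
  refine (abs_gegenbauerDeriv_le hm k (cos_mem_Icc θ)).trans ?_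
  have h1 : (k : ℝ) + (j + 1 : ℕ) + 1 ≤ (((j + 1 : ℕ) : ℝ) + 1) * ((k : ℝ) + 1) := by
    push_cast
    nlinarith [(by positivity : (0 : ℝ) ≤ (k : ℝ) * j), (by positivity : (0 : ℝ) ≤ k)]
  calc ((k : ℝ) + (j + 1 : ℕ) + 1) ^ 2 * ((k : ℝ) + 1) ^ (j + 1 - 1)
      ≤ ((((j + 1 : ℕ) : ℝ) + 1) * ((k : ℝ) + 1)) ^ 2 * ((k : ℝ) + 1) ^ (j + 1 - 1) := by gcongr
    _ = _ := by rw [Nat.add_sub_cancel]; ring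

/-- Deliberately generous: the function and its first two derivatives get the same majorant, the
single sequence used in termwise differentiation. -/
theorem abs_zonal_le_pow {m : ℕ} (hm : 0 < m) (k : ℕ) (θ : ℝ) :
    |zonal m k θ| ≤ ((m : ℝ) + 1) ^ 3 * ((k : ℝ) + 1) ^ (m + 1) := by
  refine (abs_gegenbauer_le_pow hm k (cos_mem_Icc θ)).trans ?_
  have h1 : ((k : ℝ) + 1) ^ (m - 1) ≤ ((k : ℝ) + 1) ^ (m + 1) :=
    pow_le_pow_right₀ (by linarith [(by positivity : (0 : ℝ) ≤ k)]) (by omega)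
  have h2 : (1 : ℝ) ≤ ((m : ℝ) + 1) ^ 3 :=
    one_le_pow₀ (by linarith [(by positivity : (0 : ℝ) ≤ m)])
  exact h1.trans (le_mul_of_one_le_left (by positivity) h2)

theorem abs_zonalDeriv_le_pow {m : ℕ} (hm : 0 < m) (k : ℕ) (θ : ℝ) :
    |zonalDeriv m k θ| ≤ ((m : ℝ) + 1) ^ 3 * ((k : ℝ) + 1) ^ (m + 1) := by
  have h1 := abs_gegenbauerDeriv_cos_le hm k θ
  have h2 : ((m : ℝ) + 1) ^ 2 ≤ ((m : ℝ) + 1) ^ 3 :=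
    pow_le_pow_right₀ (by linarith [(by positivity : (0 : ℝ) ≤ m)]) (by omega)
  rw [zonalDeriv, abs_mul, abs_neg]
  calc _ ≤ 1 * (((m : ℝ) + 1) ^ 2 * ((k : ℝ) + 1) ^ (m + 1)) := by
        gcongr
        exact Real.abs_sin_le_one θ
    _ ≤ _ := by rw [one_mul]; gcongr

theorem abs_zonalDerivTwo_le_pow {m : ℕ} (hm : 0 < m) (k : ℕ) (θ : ℝ) :
    |zonalDerivTwo m k θ| ≤ ((m : ℝ) + 1) ^ 3 * ((k : ℝ) + 1) ^ (m + 1) := by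
  have h1 := abs_gegenbauerDeriv_cos_le hm k θ
  have h3 := abs_gegenbauer_le_pow hm k (cos_mem_Icc θ)
  obtain ⟨j, rfl⟩ : ∃ j, m = j + 1 := ⟨m - 1, by omega⟩
  rw [zonalDerivTwo]
  have hk0 : (0 : ℝ) ≤ k := by positivity
  have hj0 : (0 : ℝ) ≤ j := by positivity
  calc _ ≤ |((j + 1 : ℕ) : ℝ) * Real.cos θ
            * gegenbauerDeriv (((j + 1 : ℕ) : ℝ) / 2) (Real.cos θ) k|
          + |(k : ℝ) * ((k : ℝ) + (j + 1 : ℕ)) * zonal (j + 1) k θ| := abs_sub _ _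
    _ ≤ ((j + 1 : ℕ) : ℝ) * 1 * ((((j + 1 : ℕ) : ℝ) + 1) ^ 2 * ((k : ℝ) + 1) ^ (j + 1 + 1))
        + (k : ℝ) * ((k : ℝ) + (j + 1 : ℕ)) * ((k : ℝ) + 1) ^ (j + 1 - 1) := by
      rw [abs_mul, abs_mul, abs_mul ((k : ℝ) * _),
        abs_of_nonneg (by positivity : (0 : ℝ) ≤ ((j + 1 : ℕ) : ℝ)),
        abs_of_nonneg (by positivity : (0 : ℝ) ≤ (k : ℝ) * ((k : ℝ) + (j + 1 : ℕ)))]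
      gcongr
      · exact Real.abs_cos_le_one θ
      · exact h3
    _ ≤ ((j + 1 : ℕ) : ℝ) * 1 * ((((j + 1 : ℕ) : ℝ) + 1) ^ 2 * ((k : ℝ) + 1) ^ (j + 1 + 1))
        + (((j + 1 : ℕ) : ℝ) + 1) * ((k : ℝ) + 1) ^ 2 * ((k : ℝ) + 1) ^ (j + 1 - 1) := by
      refine add_le_add_right (mul_le_mul_of_nonneg_right ?_ (by positivity)) _
      push_cast
      nlinarith [mul_nonneg hk0 hj0, mul_nonneg hk0 hk0, mul_nonneg (mul_nonneg hk0 hk0) hj0]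
    _ = (((j : ℝ) + 1) * ((j : ℝ) + 2) ^ 2 + ((j : ℝ) + 2)) * ((k : ℝ) + 1) ^ (j + 2) := by
      rw [Nat.add_sub_cancel]; push_cast; ring
    _ ≤ _ := by
      push_cast
      gcongr
      nlinarith [mul_nonneg hj0 hj0]

/-! ### Orthogonality -/

/-- The squared norm of `zonal m k` for the weight `sin^m`. -/
def zonalNormSq (m k : ℕ) : ℝ := ∫ θ in (0 : ℝ)..Real.pi, zonal m k θ * zonal m k θ * Real.sin θ ^ m

/-- Sturm–Liouville orthogonality: by the Lagrange identity, the difference of eigenvalues times the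
integrand is an exact derivative, of a function that vanishes with sin θ at both ends. -/
theorem integral_zonal_mul_zonal {m : ℕ} {j k : ℕ} (hjk : j ≠ k) :
    ∫ θ in (0 : ℝ)..Real.pi, zonal m j θ * zonal m k θ * Real.sin θ ^ m = 0 := by
  have hd : ∀ (i : ℕ) (θ : ℝ), HasDerivAt
      (fun t => Real.sin t ^ (m + 1) * gegenbauerDeriv ((m : ℝ) / 2) (Real.cos t) i)
      ((i : ℝ) * ((i : ℝ) + m) * Real.sin θ ^ m * zonal m i θ) θ := by
    intro i θ
    have := ((Real.hasDerivAt_sin θ).pow (m + 1)).mul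
      (hasDerivAt_gegenbauerDeriv_cos ((m : ℝ) / 2) i θ)
    refine this.congr_deriv ?_
    have h := gegenbauer_ode ((m : ℝ) / 2) (Real.cos θ) i
    have hs := Real.sin_sq_add_cos_sq θ
    simp only [zonal, Pi.pow_apply, Nat.add_sub_cancel]
    push_cast
    linear_combination (-Real.sin θ ^ m) * h
      - Real.sin θ ^ m * deriv (fun y => gegenbauerDeriv ((m : ℝ) / 2) y i) (Real.cos θ) * hs
  have hL : ∀ θ : ℝ, HasDerivAt
      (fun t => Real.sin t ^ (m + 1) * gegenbauerDeriv ((m : ℝ) / 2) (Real.cos t) j * zonal m k t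
        - Real.sin t ^ (m + 1) * gegenbauerDeriv ((m : ℝ) / 2) (Real.cos t) k * zonal m j t)
      (((j : ℝ) * ((j : ℝ) + m) - (k : ℝ) * ((k : ℝ) + m))
        * (zonal m j θ * zonal m k θ * Real.sin θ ^ m)) θ := by
    intro θ
    refine (((hd j θ).mul (hasDerivAt_zonal m k θ)).sub
      ((hd k θ).mul (hasDerivAt_zonal m j θ))).congr_deriv ?_
    simp only [zonalDeriv]
    ring
  have hcont : Continuous fun θ => ((j : ℝ) * ((j : ℝ) + m) - (k : ℝ) * ((k : ℝ) + m))
        * (zonal m j θ * zonal m k θ * Real.sin θ ^ m) := by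
    have := continuous_zonal m j
    have := continuous_zonal m k
    fun_prop
  have h := intervalIntegral.integral_eq_sub_of_hasDerivAt (a := 0) (b := Real.pi)
    (fun θ _ => hL θ) (hcont.intervalIntegrable _ _)
  rw [intervalIntegral.integral_const_mul] at h
  simp only [Real.sin_pi, Real.sin_zero, zero_pow (Nat.succ_ne_zero m), zero_mul, sub_zero] at h
  refine (mul_eq_zero.1 h).resolve_left ?_
  have : (j : ℝ) ≠ k := by exact_mod_cast hjk
  have h2 : (j : ℝ) * ((j : ℝ) + m) - (k : ℝ) * ((k : ℝ) + m)
      = ((j : ℝ) - k) * ((j : ℝ) + k + m) := by ring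
  rw [h2]
  refine mul_ne_zero (sub_ne_zero.2 this) ?_
  rcases Nat.eq_zero_or_pos j with rfl | hj
  · have : 0 < k := Nat.pos_of_ne_zero (Ne.symm hjk)
    positivity
  · positivity

/-- The integral of cos θ Z_k Z_{k+1} is evaluated in two ways, from the recurrence paired with
Z_{k+1} and from the next recurrence paired with Z_k. Orthogonality removes the outer terms, and
eliminating the integral leaves the ratio of the norms. -/
theorem zonalNormSq_succ (m k : ℕ) :
    ((k : ℝ) + 1) * ((k : ℝ) + 1 + (m : ℝ) / 2) * zonalNormSq m (k + 1)
      = ((k : ℝ) + (m : ℝ) / 2) * ((k : ℝ) + m) * zonalNormSq m k := by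
  have hz := continuous_zonal m
  have hi : ∀ i j : ℕ, IntervalIntegrable (fun θ => zonal m i θ * zonal m j θ * Real.sin θ ^ m)
      MeasureTheory.volume 0 Real.pi := fun i j => by
    have := hz i
    have := hz j
    exact Continuous.intervalIntegrable (by fun_prop) _ _
  let X : ℝ := ∫ θ in (0 : ℝ)..Real.pi,
    Real.cos θ * (zonal m k θ * zonal m (k + 1) θ * Real.sin θ ^ m)
  have h1 : ((k : ℝ) + 1) * zonalNormSq m (k + 1) = 2 * ((k : ℝ) + (m : ℝ) / 2) * X := by
    cases k with
    | zero =>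
      simp only [zonalNormSq, X]
      rw [← intervalIntegral.integral_const_mul, ← intervalIntegral.integral_const_mul]
      congr 1
      ext θ
      simp [zonal, gegenbauer]
      ring
    | succ k =>
      have h0 := integral_zonal_mul_zonal (m := m) (j := k) (k := k + 2) (by omega)
      have : ((k : ℝ) + 2) * zonalNormSq m (k + 2) = 2 * ((k : ℝ) + 1 + (m : ℝ) / 2) * X
          - ((k : ℝ) + m) * ∫ θ in (0 : ℝ)..Real.pi,
            zonal m k θ * zonal m (k + 2) θ * Real.sin θ ^ m := by
        simp only [zonalNormSq, X]
        rw [← intervalIntegral.integral_const_mul, ← intervalIntegral.integral_const_mul,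
          ← intervalIntegral.integral_const_mul, ← intervalIntegral.integral_sub]
        · congr 1
          ext θ
          have h := gegenbauer_recurrence ((m : ℝ) / 2) (Real.cos θ) k
          simp only [zonal]
          linear_combination gegenbauer ((m : ℝ) / 2) (Real.cos θ) (k + 2) * Real.sin θ ^ m * h
        · have := hz (k + 1)
          have := hz (k + 1 + 1)
          exact Continuous.intervalIntegrable (by fun_prop) _ _
        · exact (hi _ _).const_mul _
      rw [h0] at this
      push_cast
      linarith
  have h2 : ((k : ℝ) + m) * zonalNormSq m k = 2 * ((k : ℝ) + 1 + (m : ℝ) / 2) * X := by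
    have h0 := integral_zonal_mul_zonal (m := m) (j := k + 2) (k := k) (by omega)
    have : ((k : ℝ) + 2) * ∫ θ in (0 : ℝ)..Real.pi,
            zonal m (k + 2) θ * zonal m k θ * Real.sin θ ^ m
        = 2 * ((k : ℝ) + 1 + (m : ℝ) / 2) * X - ((k : ℝ) + m) * zonalNormSq m k := by
      simp only [zonalNormSq, X]
      rw [← intervalIntegral.integral_const_mul, ← intervalIntegral.integral_const_mul,
        ← intervalIntegral.integral_const_mul, ← intervalIntegral.integral_sub]
      · congr 1
        ext θ
        have h := gegenbauer_recurrence ((m : ℝ) / 2) (Real.cos θ) k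
        simp only [zonal]
        linear_combination gegenbauer ((m : ℝ) / 2) (Real.cos θ) k * Real.sin θ ^ m * h
      · have := hz (k + 1)
        have := hz k
        exact Continuous.intervalIntegrable (by fun_prop) _ _
      · exact (hi _ _).const_mul _
    rw [h0] at this
    linarith
  linear_combination ((k : ℝ) + 1 + (m : ℝ) / 2) * h1 - ((k : ℝ) + (m : ℝ) / 2) * h2

/-- This explains the factor 2k/(n - 2) + 1 in the kernel. Both sides obey the same first-order
recurrence in k and agree at k = 0. -/
theorem zonalNormSq_eq {m : ℕ} (hm : 0 < m) (k : ℕ) :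
    (2 * (k : ℝ) / m + 1) * zonalNormSq m k
      = zonal m k 0 * ∫ θ in (0 : ℝ)..Real.pi, Real.sin θ ^ m := by
  have hm' : (0 : ℝ) < m := by exact_mod_cast hm
  induction k with
  | zero => simp [zonalNormSq, zonal_zero_left]
  | succ k ih =>
    have h1 := zonalNormSq_succ m k
    have h2 := gegenbauer_one_succ ((m : ℝ) / 2) k
    have e : ∀ j, zonal m j 0 = gegenbauer ((m : ℝ) / 2) 1 j := fun j => by simp [zonal]
    rw [e] at *
    have hk : (k : ℝ) + 1 ≠ 0 := by positivity
    apply mul_left_cancel₀ hk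
    have h3 : ((k : ℝ) + 1) * ((2 * ((k + 1 : ℕ) : ℝ) / m + 1) * zonalNormSq m (k + 1))
        = ((k : ℝ) + m) * ((2 * (k : ℝ) / m + 1) * zonalNormSq m k) := by
      push_cast
      field_simp
      linear_combination 2 * h1
    rw [h3, ih]
    linear_combination (-∫ θ in (0 : ℝ)..Real.pi, Real.sin θ ^ m) * h2

theorem zonalNormSq_pos {m : ℕ} (hm : 0 < m) (k : ℕ) : 0 < zonalNormSq m k := by
  have h := zonalNormSq_eq hm k
  have h1 : 0 < zonal m k 0 * ∫ θ in (0 : ℝ)..Real.pi, Real.sin θ ^ m :=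
    mul_pos (zonal_apply_zero_pos hm k) (integral_sin_pow_pos m)
  rw [← h] at h1
  exact pos_of_mul_pos_right h1 (by positivity)

theorem integral_sin_pow_eq_Gamma (m : ℕ) :
    ∫ θ in (0 : ℝ)..Real.pi, Real.sin θ ^ m
      = √Real.pi * Real.Gamma (((m : ℝ) + 1) / 2) / Real.Gamma (((m : ℝ) + 2) / 2) := by
  induction m using Nat.twoStepInduction with
  | zero =>
    have h := Real.Gamma_one_half_eq
    rw [one_div] at h
    simp [h, Real.mul_self_sqrt Real.pi_pos.le]
  | one =>
    have h := Real.Gamma_add_one (s := 1 / 2) (by norm_num)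
    rw [Real.Gamma_one_half_eq] at h
    norm_num at h ⊢
    rw [h]
    have : √Real.pi ≠ 0 := by positivity
    field_simp
  | more m h0 _ =>
    rw [integral_sin_pow, h0]
    have h1 := Real.Gamma_add_one (s := ((m : ℝ) + 1) / 2) (by positivity)
    have h2 := Real.Gamma_add_one (s := ((m : ℝ) + 2) / 2) (by positivity)
    have h3 : 0 < Real.Gamma (((m : ℝ) + 2) / 2) := Real.Gamma_pos_of_pos (by positivity)
    push_cast
    rw [show ((m : ℝ) + 2 + 1) / 2 = ((m : ℝ) + 1) / 2 + 1 by ring,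
      show ((m : ℝ) + 2 + 2) / 2 = ((m : ℝ) + 2) / 2 + 1 by ring, h1, h2]
    simp
    field_simp

/-- The prefactor of the kernel is the reciprocal of the total mass of the weight. -/
theorem surfaceArea_div_mul_integral_sin_pow (m : ℕ) :
    surfaceArea (((m + 2 : ℕ) : ℝ) - 1) / surfaceArea (m + 2 : ℕ)
      * ∫ θ in (0 : ℝ)..Real.pi, Real.sin θ ^ m = 1 := by
  rw [integral_sin_pow_eq_Gamma]
  have h1 : 0 < Real.Gamma (((m : ℝ) + 1) / 2) := Real.Gamma_pos_of_pos (by positivity)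
  have h2 : 0 < Real.Gamma (((m : ℝ) + 2) / 2) := Real.Gamma_pos_of_pos (by positivity)
  have h3 : Real.pi ^ (((m : ℝ) + 2) / 2) = Real.pi ^ (((m : ℝ) + 1) / 2) * √Real.pi := by
    rw [Real.sqrt_eq_rpow, ← Real.rpow_add Real.pi_pos]
    congr 1
    ring
  unfold surfaceArea
  push_cast
  rw [show (m : ℝ) + 2 - 1 = m + 1 by ring, h3]
  have : 0 < √Real.pi := by positivity
  have : 0 < Real.pi ^ (((m : ℝ) + 1) / 2) := by positivity
  field_simp

/-! ### Power series with coefficients of polynomial growth -/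

theorem summable_add_one_pow_mul_geometric (p : ℕ) {r : ℝ} (h0 : 0 ≤ r) (h1 : r < 1) :
    Summable fun j : ℕ => ((j : ℝ) + 1) ^ p * r ^ j := by
  -- The index shift divides by the ratio, and r may be 0; the midpoint s is positive and still
  -- below 1.
  set s : ℝ := (r + 1) / 2 with hs
  have hs0 : 0 < s := by positivity
  have hs1 : s < 1 := by linarith
  have h := (summable_nat_add_iff 1).2
    (summable_pow_mul_geometric_of_norm_lt_one p (r := s) (by rwa [Real.norm_of_nonneg hs0.le]))
  have h2 := h.mul_left s⁻¹
  refine Summable.of_nonneg_of_le (fun j => by positivity) (fun j => ?_) h2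
  calc ((j : ℝ) + 1) ^ p * r ^ j ≤ ((j : ℝ) + 1) ^ p * s ^ j := by gcongr; linarith
    _ = s⁻¹ * (((j + 1 : ℕ) : ℝ) ^ p * s ^ (j + 1)) := by
      push_cast; field_simp; ring

theorem summable_mul_pow_of_polynomial_growth {a : ℕ → ℝ} {K : ℝ} {p : ℕ}
    (ha : ∀ j : ℕ, |a j| ≤ K * ((j : ℝ) + 1) ^ p) {x : ℝ} (hx : |x| < 1) :
    Summable fun j => a j * x ^ j := by
  refine Summable.of_norm_bounded
    ((summable_add_one_pow_mul_geometric p (abs_nonneg x) hx).mul_left K) fun j => ?_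
  rw [norm_mul, norm_pow, Real.norm_eq_abs, Real.norm_eq_abs, ← mul_assoc]
  gcongr
  exact ha j

/-- The coefficients of the derived series again grow polynomially, so termwise differentiation can
be iterated. The factor 2^p comes from j + 2 ≤ 2 (j + 1). -/
theorem polynomial_growth_succ {a : ℕ → ℝ} {K : ℝ} {p : ℕ}
    (ha : ∀ j : ℕ, |a j| ≤ K * ((j : ℝ) + 1) ^ p) (j : ℕ) :
    |((j : ℝ) + 1) * a (j + 1)| ≤ (K * 2 ^ p) * ((j : ℝ) + 1) ^ (p + 1) := by
  have hK : 0 ≤ K := by simpa using (abs_nonneg _).trans (ha 0)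
  rw [abs_mul, abs_of_nonneg (by positivity : (0 : ℝ) ≤ (j : ℝ) + 1)]
  have h := ha (j + 1)
  calc ((j : ℝ) + 1) * |a (j + 1)| ≤ ((j : ℝ) + 1) * (K * (2 * ((j : ℝ) + 1)) ^ p) := by
        gcongr
        refine h.trans ?_
        gcongr
        push_cast
        linarith [(by positivity : (0 : ℝ) ≤ j)]
    _ = _ := by rw [mul_pow]; ring

theorem hasDerivAt_tsum_mul_pow {a : ℕ → ℝ} {K : ℝ} {p : ℕ}
    (ha : ∀ j : ℕ, |a j| ≤ K * ((j : ℝ) + 1) ^ p) {x : ℝ} (hx : |x| < 1) :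
    HasDerivAt (fun y => ∑' j : ℕ, a j * y ^ j) (∑' j : ℕ, (((j : ℝ) + 1) * a (j + 1)) * x ^ j)
      x := by
  have hK : 0 ≤ K := by simpa using (abs_nonneg _).trans (ha 0)
  obtain ⟨r, hr, hr1⟩ := exists_between hx
  have hr0 : 0 < r := (abs_nonneg x).trans_lt hr
  have hu : Summable fun j : ℕ => K * r⁻¹ * (((j : ℝ) + 1) ^ (p + 1) * r ^ j) :=
    (summable_add_one_pow_mul_geometric (p + 1) hr0.le hr1).mul_left _
  have h := hasDerivAt_tsum_of_isPreconnected (t := Metric.ball (0 : ℝ) r)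
    (g := fun j y => a j * y ^ j) (g' := fun j y => a j * ((j : ℝ) * y ^ (j - 1)))
    (y₀ := 0) (y := x) hu
    Metric.isOpen_ball (convex_ball _ _).isPreconnected
    (fun j y _ => (hasDerivAt_pow j y).const_mul (a j)) ?_ (Metric.mem_ball_self hr0) ?_
    (by simpa using hr)
  · refine h.congr_deriv ?_
    have hs : Summable fun j : ℕ => a j * ((j : ℝ) * x ^ (j - 1)) := by
      rw [← summable_nat_add_iff 1]
      refine (summable_mul_pow_of_polynomial_growth (polynomial_growth_succ ha) hx).congr
        fun j => ?_
      push_cast [Nat.add_sub_cancel]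
      ring
    rw [hs.tsum_eq_zero_add]
    simp only [Nat.cast_zero, zero_mul, mul_zero, zero_add]
    refine tsum_congr fun j => ?_
    push_cast [Nat.add_sub_cancel]
    ring
  · intro j y hy
    rw [mem_ball_zero_iff, Real.norm_eq_abs] at hy
    rw [norm_mul, norm_mul, norm_pow, Real.norm_eq_abs, Real.norm_eq_abs, Real.norm_eq_abs,
      Nat.abs_cast]
    rcases j with _ | j
    · simp only [Nat.cast_zero, zero_mul, mul_zero]
      positivity
    · rw [Nat.add_sub_cancel]
      have h1 := ha (j + 1)
      calc |a (j + 1)| * (((j + 1 : ℕ) : ℝ) * |y| ^ j)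
          ≤ (K * (((j + 1 : ℕ) : ℝ) + 1) ^ p) * ((((j + 1 : ℕ) : ℝ) + 1) * r ^ j) := by
            gcongr
            linarith
        _ = _ := by
            field_simp; ring
  · exact summable_mul_pow_of_polynomial_growth ha (by simp)

/-- A power series whose coefficients satisfy the hypergeometric recurrence solves the
hypergeometric differential equation. -/
theorem hypergeometric_ode {A : ℕ → ℝ} {K : ℝ} {p : ℕ}
    (hA : ∀ j : ℕ, |A j| ≤ K * ((j : ℝ) + 1) ^ p) {a b c : ℝ}
    (hrec : ∀ j : ℕ, ((j : ℝ) + 1) * (c + j) * A (j + 1) = (a + j) * (b + j) * A j)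
    {x : ℝ} (hx : |x| < 1) :
    x * (1 - x) * (∑' j : ℕ, (((j : ℝ) + 1) * ((((j + 1 : ℕ) : ℝ) + 1) * A (j + 1 + 1))) * x ^ j)
      + (c - (a + b + 1) * x) * (∑' j : ℕ, (((j : ℝ) + 1) * A (j + 1)) * x ^ j)
      - a * b * (∑' j : ℕ, A j * x ^ j) = 0 := by
  have s0 := (summable_mul_pow_of_polynomial_growth hA hx).hasSum
  have g1 := polynomial_growth_succ hA
  have s1 := (summable_mul_pow_of_polynomial_growth g1 hx).hasSum
  have s2 := (summable_mul_pow_of_polynomial_growth (polynomial_growth_succ g1) hx).hasSum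
  -- Multiplication by x lowers the coefficient index. The factors j and j (j - 1) below make the
  -- new zeroth coefficient vanish, so all terms of the equation become series in the same powers of
  -- x.
  have shift : ∀ {B : ℕ → ℝ} {S : ℝ}, HasSum (fun j : ℕ => B (j + 1) * x ^ j) S → B 0 = 0 →
      HasSum (fun j : ℕ => B j * x ^ j) (x * S) := by
    intro B S h h0
    have := (hasSum_nat_add_iff (f := fun j : ℕ => B j * x ^ j) 1).1
      ((h.mul_left x).congr_fun fun j => by ring)
    simpa [h0] using this
  have t1 := shift (B := fun j => (j : ℝ) * A j) (by simpa using s1) (by simp)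
  have t2 := shift (B := fun j => (j : ℝ) * (((j : ℝ) + 1) * A (j + 1))) (by simpa using s2)
    (by simp)
  have t3 := shift (B := fun j => (j : ℝ) * ((j : ℝ) - 1) * A j)
    (t2.congr_fun fun j => by push_cast; ring) (by simp)
  have h := (((t2.sub t3).add (s1.mul_left c)).sub (t1.mul_left (a + b + 1))).sub
    (s0.mul_left (a * b))
  have h0 : HasSum (fun _ : ℕ => (0 : ℝ)) _ := h.congr_fun fun j => by
    linear_combination (-x ^ j) * hrec j
  have := h0.unique hasSum_zero
  push_cast at this ⊢
  linear_combination this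

/-! ### The radial functions -/

/-- The coefficients of the hypergeometric factor of `radial (m + 2) k`. -/
def radialCoeff (m k j : ℕ) : ℝ :=
  ordinaryHypergeometricCoefficient (k : ℝ) (-((m : ℝ) / 2)) ((k : ℝ) + (m : ℝ) / 2 + 1) j

theorem radialCoeff_succ (m k j : ℕ) :
    ((j : ℝ) + 1) * (((k : ℝ) + (m : ℝ) / 2 + 1) + j) * radialCoeff m k (j + 1)
      = ((k : ℝ) + j) * (-((m : ℝ) / 2) + j) * radialCoeff m k j := by
  have h1 : ((ascPochhammer ℝ j).eval ((k : ℝ) + (m : ℝ) / 2 + 1)) ≠ 0 :=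
    (ascPochhammer_pos j _ (by positivity)).ne'
  have h2 : (k : ℝ) + (m : ℝ) / 2 + 1 + j ≠ 0 := by positivity
  simp only [radialCoeff, ordinaryHypergeometricCoefficient, ascPochhammer_succ_eval,
    Nat.factorial_succ]
  push_cast
  have h3 : (j.factorial : ℝ) ≠ 0 := by positivity
  field_simp

/-- Consecutive coefficients have ratio at most 1 + m/(j + 1) in absolute value, for every k, and
Bernoulli makes the product telescope. The constant 1 is kept to match the shape of the growth
hypotheses. -/
theorem abs_radialCoeff_le (m k j : ℕ) : |radialCoeff m k j| ≤ 1 * ((j : ℝ) + 1) ^ m := by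
  rw [one_mul]
  induction j with
  | zero => simp [radialCoeff, ordinaryHypergeometricCoefficient]
  | succ j ih =>
    have h := congrArg abs (radialCoeff_succ m k j)
    rw [abs_mul, abs_mul (_ * _) (radialCoeff m k j), abs_mul ((k : ℝ) + j),
      abs_of_nonneg (by positivity : (0 : ℝ) ≤ ((j : ℝ) + 1) * ((k : ℝ) + (m : ℝ) / 2 + 1 + j)),
      abs_of_nonneg (by positivity : (0 : ℝ) ≤ (k : ℝ) + j)] at h
    have hb : |-((m : ℝ) / 2) + j| ≤ (j : ℝ) + 1 + m := by
      have : (0 : ℝ) ≤ m := by positivity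
      have : (0 : ℝ) ≤ j := by positivity
      rw [abs_le]; constructor <;> linarith
    have hbern := one_add_mul_le_pow (a := 1 / ((j : ℝ) + 1))
      (by have : 0 < 1 / ((j : ℝ) + 1) := by positivity
          linarith) m
    have hpos : (0 : ℝ) < ((j : ℝ) + 1) * ((k : ℝ) + (m : ℝ) / 2 + 1 + j) := by positivity
    refine le_of_mul_le_mul_left ?_ hpos
    rw [h]
    calc ((k : ℝ) + j) * |-((m : ℝ) / 2) + j| * |radialCoeff m k j|
        ≤ ((k : ℝ) + (m : ℝ) / 2 + 1 + j) * ((j : ℝ) + 1 + m) * ((j : ℝ) + 1) ^ m := by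
          gcongr
          linarith [(by positivity : (0 : ℝ) ≤ (m : ℝ) / 2)]
      _ = ((j : ℝ) + 1) * ((k : ℝ) + (m : ℝ) / 2 + 1 + j)
            * ((1 + m * (1 / ((j : ℝ) + 1))) * ((j : ℝ) + 1) ^ m) := by
          field_simp
      _ ≤ ((j : ℝ) + 1) * ((k : ℝ) + (m : ℝ) / 2 + 1 + j)
            * ((1 + 1 / ((j : ℝ) + 1)) ^ m * ((j : ℝ) + 1) ^ m) := by gcongr
      _ = _ := by
          rw [← mul_pow]
          congr 2
          push_cast
          field_simp

/-- The hypergeometric factor of `radial (m + 2) k`, as a function of `tanh²(η/2)`. -/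
def radialFactor (m k : ℕ) (x : ℝ) : ℝ := ∑' j : ℕ, radialCoeff m k j * x ^ j

/-- The derivative of `radialFactor m k`. -/
def radialFactorDeriv (m k : ℕ) (x : ℝ) : ℝ :=
  ∑' j : ℕ, (((j : ℝ) + 1) * radialCoeff m k (j + 1)) * x ^ j

/-- The second derivative of `radialFactor m k`. -/
def radialFactorDerivTwo (m k : ℕ) (x : ℝ) : ℝ :=
  ∑' j : ℕ, (((j : ℝ) + 1) * ((((j + 1 : ℕ) : ℝ) + 1) * radialCoeff m k (j + 1 + 1))) * x ^ j

theorem hasDerivAt_radialFactor (m k : ℕ) {x : ℝ} (hx : |x| < 1) :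
    HasDerivAt (radialFactor m k) (radialFactorDeriv m k x) x :=
  hasDerivAt_tsum_mul_pow (abs_radialCoeff_le m k) hx

theorem hasDerivAt_radialFactorDeriv (m k : ℕ) {x : ℝ} (hx : |x| < 1) :
    HasDerivAt (radialFactorDeriv m k) (radialFactorDerivTwo m k x) x :=
  hasDerivAt_tsum_mul_pow (polynomial_growth_succ (abs_radialCoeff_le m k)) hx

theorem radialFactor_ode (m k : ℕ) {x : ℝ} (hx : |x| < 1) :
    x * (1 - x) * radialFactorDerivTwo m k x
      + ((k : ℝ) + (m : ℝ) / 2 + 1 - ((k : ℝ) + -((m : ℝ) / 2) + 1) * x) * radialFactorDeriv m k x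
      - k * -((m : ℝ) / 2) * radialFactor m k x = 0 :=
  hypergeometric_ode (abs_radialCoeff_le m k) (radialCoeff_succ m k) hx

theorem radialFactor_zero (m k : ℕ) : radialFactor m k 0 = 1 := by
  rw [radialFactor, tsum_eq_single 0 (fun j hj => by simp [hj])]
  simp [radialCoeff, ordinaryHypergeometricCoefficient]

theorem radial_eq (m k : ℕ) (η : ℝ) :
    radial (m + 2) k η
      = Real.tanh (η / 2) ^ k * radialFactor m k (Real.tanh (η / 2) ^ 2) := by
  unfold radial radialFactor radialCoeff
  rw [ordinaryHypergeometric_eq_tsum]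
  simp only [smul_eq_mul, ordinaryHypergeometricCoefficient]
  push_cast
  rw [show 1 - ((m : ℝ) + 2) / 2 = -((m : ℝ) / 2) by ring,
    show (k : ℝ) + ((m : ℝ) + 2) / 2 = (k : ℝ) + (m : ℝ) / 2 + 1 by ring]

/-- `tanh (η / 2)`, the Euclidean radius in the Poincaré ball model. -/
def halfTanh (η : ℝ) : ℝ := Real.tanh (η / 2)

theorem hasDerivAt_halfTanh (η : ℝ) : HasDerivAt halfTanh ((1 - halfTanh η ^ 2) / 2) η := by
  have hf : halfTanh = fun x => Real.sinh (x / 2) / Real.cosh (x / 2) := by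
    ext x; exact Real.tanh_eq_sinh_div_cosh _
  have hc : Real.cosh (η / 2) ≠ 0 := (Real.cosh_pos _).ne'
  have h2 : HasDerivAt (fun x : ℝ => x / 2) (1 / 2) η := (hasDerivAt_id η).div_const 2
  rw [hf]
  refine (h2.sinh.div h2.cosh hc).congr_deriv ?_
  field_simp

theorem continuous_halfTanh : Continuous halfTanh :=
  continuous_iff_continuousAt.2 fun η => (hasDerivAt_halfTanh η).continuousAt

theorem halfTanh_sq_lt_one (η : ℝ) : halfTanh η ^ 2 < 1 := Real.tanh_sq_lt_one _

theorem abs_halfTanh_sq_lt_one (η : ℝ) : |halfTanh η ^ 2| < 1 := by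
  rw [abs_of_nonneg (sq_nonneg _)]; exact halfTanh_sq_lt_one η

theorem halfTanh_zero : halfTanh 0 = 0 := by simp [halfTanh]

theorem strictMono_halfTanh : StrictMono halfTanh := by
  refine strictMono_of_deriv_pos fun η => ?_
  rw [(hasDerivAt_halfTanh η).deriv]
  linarith [halfTanh_sq_lt_one η]

theorem halfTanh_pos {η : ℝ} (hη : 0 < η) : 0 < halfTanh η := by
  simpa [halfTanh_zero] using strictMono_halfTanh hη

/-- With this and `cosh_eq_halfTanh` the coefficients of the radial equation are rational in t =
tanh(η/2), which reduces it to algebra. -/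
theorem sinh_eq_halfTanh (η : ℝ) : Real.sinh η = 2 * halfTanh η / (1 - halfTanh η ^ 2) := by
  have hc : Real.cosh (η / 2) ≠ 0 := (Real.cosh_pos _).ne'
  have h1 := Real.cosh_sq (η / 2)
  have h2 : 1 - halfTanh η ^ 2 ≠ 0 := by linarith [halfTanh_sq_lt_one η]
  have h3 : Real.sinh η = 2 * Real.sinh (η / 2) * Real.cosh (η / 2) := by
    rw [← Real.sinh_two_mul]; congr 1; ring
  rw [eq_div_iff h2, h3, halfTanh, Real.tanh_eq_sinh_div_cosh]
  field_simp
  linear_combination Real.sinh (η / 2) * h1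

theorem cosh_eq_halfTanh (η : ℝ) :
    Real.cosh η = (1 + halfTanh η ^ 2) / (1 - halfTanh η ^ 2) := by
  have hc : Real.cosh (η / 2) ≠ 0 := (Real.cosh_pos _).ne'
  have h1 := Real.cosh_sq (η / 2)
  have h2 : 1 - halfTanh η ^ 2 ≠ 0 := by linarith [halfTanh_sq_lt_one η]
  have h3 : Real.cosh η = Real.cosh (η / 2) ^ 2 + Real.sinh (η / 2) ^ 2 := by
    rw [← Real.cosh_two_mul]; congr 1; ring
  rw [eq_div_iff h2, h3, halfTanh, Real.tanh_eq_sinh_div_cosh]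
  field_simp
  linear_combination h1

/-- The logarithmic derivative of tanh(η/2) is 1 / sinh η. -/
theorem hasDerivAt_halfTanh_pow (k : ℕ) {η : ℝ} (hη : 0 < η) :
    HasDerivAt (fun x => halfTanh x ^ k) (halfTanh η ^ k * (k / Real.sinh η)) η := by
  refine ((hasDerivAt_halfTanh η).pow k).congr_deriv ?_
  have h2 : 1 - halfTanh η ^ 2 ≠ 0 := by linarith [halfTanh_sq_lt_one η]
  have h3 := (halfTanh_pos hη).ne'
  rw [sinh_eq_halfTanh]
  cases k with
  | zero => simp
  | succ k =>
    rw [Nat.add_sub_cancel]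
    field_simp
    ring

theorem hasDerivAt_halfTanh_rpow (r : ℝ) {η : ℝ} (hη : 0 < η) :
    HasDerivAt (fun x => halfTanh x ^ r) (halfTanh η ^ r * (r / Real.sinh η)) η := by
  have h3 := halfTanh_pos hη
  refine ((hasDerivAt_halfTanh η).rpow_const (Or.inl h3.ne')).congr_deriv ?_
  have h2 : 1 - halfTanh η ^ 2 ≠ 0 := by linarith [halfTanh_sq_lt_one η]
  rw [sinh_eq_halfTanh, Real.rpow_sub_one h3.ne']
  field_simp

theorem radial_eq_halfTanh (m k : ℕ) (η : ℝ) :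
    radial (m + 2) k η = halfTanh η ^ k * radialFactor m k (halfTanh η ^ 2) := radial_eq m k η

theorem hasDerivAt_radialFactor_halfTanh (m k : ℕ) (η : ℝ) :
    HasDerivAt (fun x => radialFactor m k (halfTanh x ^ 2))
      (halfTanh η * (1 - halfTanh η ^ 2) * radialFactorDeriv m k (halfTanh η ^ 2)) η := by
  have h := (hasDerivAt_radialFactor m k (abs_halfTanh_sq_lt_one η)).comp η
    ((hasDerivAt_halfTanh η).pow 2)
  refine h.congr_deriv ?_
  push_cast
  ring

theorem hasDerivAt_radialFactorDeriv_halfTanh (m k : ℕ) (η : ℝ) :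
    HasDerivAt (fun x => radialFactorDeriv m k (halfTanh x ^ 2))
      (halfTanh η * (1 - halfTanh η ^ 2) * radialFactorDerivTwo m k (halfTanh η ^ 2)) η := by
  have h := (hasDerivAt_radialFactorDeriv m k (abs_halfTanh_sq_lt_one η)).comp η
    ((hasDerivAt_halfTanh η).pow 2)
  refine h.congr_deriv ?_
  push_cast
  ring

theorem continuous_radial (m k : ℕ) : Continuous (radial (m + 2) k) := by
  have h1 : Continuous fun x => radialFactor m k (halfTanh x ^ 2) :=
    continuous_iff_continuousAt.2 fun η => (hasDerivAt_radialFactor_halfTanh m k η).continuousAt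
  have h2 := continuous_halfTanh
  simp_rw [funext (radial_eq_halfTanh m k)]
  fun_prop

/-- The derivative of `radial (m + 2) k` on the positive half line. -/
def radialDeriv (m k : ℕ) (η : ℝ) : ℝ :=
  halfTanh η ^ k * (k / Real.sinh η * radialFactor m k (halfTanh η ^ 2)
    + halfTanh η * (1 - halfTanh η ^ 2) * radialFactorDeriv m k (halfTanh η ^ 2))

/-- The second derivative of `radial (m + 2) k` on the positive half line. -/
def radialDerivTwo (m k : ℕ) (η : ℝ) : ℝ :=
  k * ((k : ℝ) + m) / Real.sinh η ^ 2 * radial (m + 2) k η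
    - ((m : ℝ) + 1) * (Real.cosh η / Real.sinh η) * radialDeriv m k η

theorem hasDerivAt_radial (m k : ℕ) {η : ℝ} (hη : 0 < η) :
    HasDerivAt (radial (m + 2) k) (radialDeriv m k η) η := by
  simp_rw [funext (radial_eq_halfTanh m k)]
  refine ((hasDerivAt_halfTanh_pow k hη).mul (hasDerivAt_radialFactor_halfTanh m k η)).congr_deriv
    ?_
  simp only [radialDeriv]
  ring

/-- `radialDerivTwo` is the radial equation solved for E'', so this is the proof that E satisfies
the equation: the discrepancy is t^k (1 - t²) times the hypergeometric equation at t². -/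
theorem hasDerivAt_radialDeriv (m k : ℕ) {η : ℝ} (hη : 0 < η) :
    HasDerivAt (radialDeriv m k) (radialDerivTwo m k η) η := by
  have hS : Real.sinh η ≠ 0 := (Real.sinh_pos_iff.2 hη).ne'
  have h1 : HasDerivAt (fun x => (k : ℝ) / Real.sinh x)
      (-(k * Real.cosh η) / Real.sinh η ^ 2) η := by
    refine ((hasDerivAt_const η (k : ℝ)).div (Real.hasDerivAt_sinh η) hS).congr_deriv ?_
    ring
  have h2 : HasDerivAt (fun x => halfTanh x * (1 - halfTanh x ^ 2))
      ((1 - halfTanh η ^ 2) / 2 * (1 - 3 * halfTanh η ^ 2)) η := by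
    refine ((hasDerivAt_halfTanh η).mul (((hasDerivAt_halfTanh η).pow 2).const_sub 1)).congr_deriv
      ?_
    simp only [Pi.pow_apply]
    push_cast
    ring
  refine ((hasDerivAt_halfTanh_pow k hη).mul
    ((h1.mul (hasDerivAt_radialFactor_halfTanh m k η)).add
      (h2.mul (hasDerivAt_radialFactorDeriv_halfTanh m k η)))).congr_deriv ?_
  have hode := radialFactor_ode m k (abs_halfTanh_sq_lt_one η)
  have h3 := (halfTanh_pos hη).ne'
  have h4 : 1 - halfTanh η ^ 2 ≠ 0 := by linarith [halfTanh_sq_lt_one η]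
  simp only [radialDerivTwo, radialDeriv, radial_eq_halfTanh, Pi.add_apply, Pi.mul_apply]
  rw [sinh_eq_halfTanh, cosh_eq_halfTanh]
  generalize radialFactorDerivTwo m k (halfTanh η ^ 2) = G2 at *
  generalize radialFactorDeriv m k (halfTanh η ^ 2) = G1 at *
  generalize radialFactor m k (halfTanh η ^ 2) = G at *
  generalize halfTanh η = t at *
  rw [← sub_eq_zero]
  have key : t ^ k * (1 - t ^ 2) * (t ^ 2 * (1 - t ^ 2) * G2
      + ((k : ℝ) + (m : ℝ) / 2 + 1 - ((k : ℝ) + -((m : ℝ) / 2) + 1) * t ^ 2) * G1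
      - k * -((m : ℝ) / 2) * G) = 0 := by rw [hode, mul_zero]
  rw [← key]
  field_simp
  ring

/-- The flux `sinh^(m+1) η · E'(η)` of the radial function `E`, in a form that is continuous at
the centre. -/
def radialFlux (m k : ℕ) (η : ℝ) : ℝ :=
  halfTanh η ^ k * (k * Real.sinh η ^ m * radialFactor m k (halfTanh η ^ 2)
    + Real.sinh η ^ (m + 1) * (halfTanh η * (1 - halfTanh η ^ 2)
      * radialFactorDeriv m k (halfTanh η ^ 2)))

theorem radialFlux_eq (m k : ℕ) {η : ℝ} (hη : 0 < η) :
    radialFlux m k η = Real.sinh η ^ (m + 1) * radialDeriv m k η := by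
  have hS : Real.sinh η ≠ 0 := (Real.sinh_pos_iff.2 hη).ne'
  rw [radialFlux, radialDeriv]
  field_simp
  ring

theorem continuous_radialFlux (m k : ℕ) : Continuous (radialFlux m k) := by
  have h1 : Continuous fun x => radialFactor m k (halfTanh x ^ 2) :=
    continuous_iff_continuousAt.2 fun η => (hasDerivAt_radialFactor_halfTanh m k η).continuousAt
  have h2 : Continuous fun x => radialFactorDeriv m k (halfTanh x ^ 2) :=
    continuous_iff_continuousAt.2
      fun η => (hasDerivAt_radialFactorDeriv_halfTanh m k η).continuousAt
  have h3 := continuous_halfTanh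
  have h4 := Real.continuous_sinh
  unfold radialFlux
  fun_prop

theorem radialFlux_zero {m : ℕ} (hm : 0 < m) (k : ℕ) : radialFlux m k 0 = 0 := by
  simp [radialFlux, halfTanh_zero, hm.ne']

/-- The self-adjoint form of the radial equation. -/
theorem hasDerivAt_radialFlux {m : ℕ} (hm : 0 < m) (k : ℕ) {η : ℝ} (hη : 0 < η) :
    HasDerivAt (radialFlux m k)
      (k * ((k : ℝ) + m) * Real.sinh η ^ (m - 1) * radial (m + 2) k η) η := by
  have hS : Real.sinh η ≠ 0 := (Real.sinh_pos_iff.2 hη).ne'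
  have h := ((Real.hasDerivAt_sinh η).pow (m + 1)).mul (hasDerivAt_radialDeriv m k hη)
  have he : radialFlux m k =ᶠ[𝓝 η] (Real.sinh ^ (m + 1) * radialDeriv m k) := by
    filter_upwards [lt_mem_nhds hη] with x hx
    exact radialFlux_eq m k hx
  refine (h.congr_of_eventuallyEq he).congr_deriv ?_
  obtain ⟨j, rfl⟩ : ∃ j, m = j + 1 := ⟨m - 1, by omega⟩
  simp only [radialDerivTwo, Nat.add_sub_cancel, Pi.pow_apply]
  push_cast
  field_simp
  ring

/-- An energy estimate that needs no sign of E: the product has as derivative a sum of squares with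
nonnegative weights, and it vanishes at the centre. -/
theorem radial_mul_radialFlux_nonneg {m : ℕ} (hm : 0 < m) (k : ℕ) {η : ℝ} (hη : 0 ≤ η) :
    0 ≤ radial (m + 2) k η * radialFlux m k η := by
  have hmono : MonotoneOn (radial (m + 2) k * radialFlux m k) (Ici 0) := by
    apply monotoneOn_of_deriv_nonneg (convex_Ici 0)
    · exact ((continuous_radial m k).mul (continuous_radialFlux m k)).continuousOn
    · intro x hx
      rw [interior_Ici] at hx
      exact ((hasDerivAt_radial m k hx).mul
        (hasDerivAt_radialFlux hm k hx)).differentiableAt.differentiableWithinAt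
    · intro x hx
      rw [interior_Ici] at hx
      have hS : 0 < Real.sinh x := Real.sinh_pos_iff.2 hx
      rw [((hasDerivAt_radial m k hx).mul (hasDerivAt_radialFlux hm k hx)).deriv,
        radialFlux_eq m k hx]
      have e : radialDeriv m k x * (Real.sinh x ^ (m + 1) * radialDeriv m k x)
          + radial (m + 2) k x * (k * ((k : ℝ) + m) * Real.sinh x ^ (m - 1) * radial (m + 2) k x)
          = Real.sinh x ^ (m + 1) * radialDeriv m k x ^ 2
            + k * ((k : ℝ) + m) * Real.sinh x ^ (m - 1) * radial (m + 2) k x ^ 2 := by ring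
      rw [e]
      positivity
  have := hmono (self_mem_Ici (a := (0 : ℝ))) hη hη
  simpa [radialFlux_zero hm] using this

theorem eventually_radial_pos (m k : ℕ) : ∀ᶠ η in 𝓝[>] (0 : ℝ), 0 < radial (m + 2) k η := by
  have h1 : ContinuousAt (fun x => radialFactor m k (halfTanh x ^ 2)) 0 :=
    (hasDerivAt_radialFactor_halfTanh m k 0).continuousAt
  have h2 : ∀ᶠ x in 𝓝 (0 : ℝ), 0 < radialFactor m k (halfTanh x ^ 2) :=
    h1.eventually_const_lt (by simp [halfTanh_zero, radialFactor_zero])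
  filter_upwards [nhdsWithin_le_nhds h2, self_mem_nhdsWithin] with x hx hx0
  rw [radial_eq_halfTanh]
  exact mul_pos (pow_pos (halfTanh_pos hx0) k) hx

/-- Positivity cannot be read off the hypergeometric series, whose parameter 1 - n/2 is negative.
Instead E² is nondecreasing and E is positive near the centre; hence E never vanishes, and it keeps
its sign. -/
theorem radial_pos {m : ℕ} (hm : 0 < m) (k : ℕ) {η : ℝ} (hη : 0 < η) :
    0 < radial (m + 2) k η := by
  have hmono : MonotoneOn (fun x => radial (m + 2) k x ^ 2) (Ici 0) := by
    apply monotoneOn_of_deriv_nonneg (convex_Ici 0)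
    · exact ((continuous_radial m k).pow 2).continuousOn
    · intro x hx
      rw [interior_Ici] at hx
      exact ((hasDerivAt_radial m k hx).pow 2).differentiableAt.differentiableWithinAt
    · intro x hx
      rw [interior_Ici] at hx
      have hS : 0 < Real.sinh x := Real.sinh_pos_iff.2 hx
      have h := radial_mul_radialFlux_nonneg hm k (le_of_lt hx)
      rw [radialFlux_eq m k hx] at h
      have hd := ((hasDerivAt_radial m k hx).pow 2).deriv
      rw [show (fun x => radial (m + 2) k x ^ 2) = radial (m + 2) k ^ 2 from rfl, hd]
      have h' : 0 ≤ Real.sinh x ^ (m + 1) * (radial (m + 2) k x * radialDeriv m k x) := by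
        linarith [h]
      have := nonneg_of_mul_nonneg_right h' (by positivity)
      push_cast
      simp only [pow_one]
      linarith
  have hne : ∀ x, 0 < x → radial (m + 2) k x ≠ 0 := by
    intro x hx h0
    obtain ⟨y, hy, hy0, hyx⟩ := ((eventually_radial_pos m k).and
      (Ioo_mem_nhdsGT hx)).exists
    have := hmono (le_of_lt hy0) (le_of_lt hx) hyx.le
    simp only [h0] at this
    nlinarith
  obtain ⟨y, hy, hy0, hyx⟩ := ((eventually_radial_pos m k).and (Ioo_mem_nhdsGT hη)).exists
  by_contra hneg
  obtain ⟨z, hz, hz0⟩ := intermediate_value_Icc' hyx.le (continuous_radial m k).continuousOn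
    ⟨not_lt.1 hneg, hy.le⟩
  exact hne z (hy0.trans_le hz.1) hz0

theorem radialDeriv_nonneg {m : ℕ} (hm : 0 < m) (k : ℕ) {η : ℝ} (hη : 0 < η) :
    0 ≤ radialDeriv m k η := by
  have hS : 0 < Real.sinh η := Real.sinh_pos_iff.2 hη
  have h := radial_mul_radialFlux_nonneg hm k hη.le
  rw [radialFlux_eq m k hη] at h
  exact nonneg_of_mul_nonneg_right (nonneg_of_mul_nonneg_right h (radial_pos hm k hη))
    (by positivity)

theorem radial_nonneg {m : ℕ} (hm : 0 < m) (k : ℕ) {η : ℝ} (hη : 0 ≤ η) :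
    0 ≤ radial (m + 2) k η := by
  rcases hη.eq_or_lt with rfl | h
  · rw [radial_eq_halfTanh, halfTanh_zero]
    simp [radialFactor_zero]
  · exact (radial_pos hm k h).le

theorem monotoneOn_radial {m : ℕ} (hm : 0 < m) (k : ℕ) :
    MonotoneOn (radial (m + 2) k) (Ici 0) := by
  apply monotoneOn_of_deriv_nonneg (convex_Ici 0) (continuous_radial m k).continuousOn
  · intro x hx
    rw [interior_Ici] at hx
    exact (hasDerivAt_radial m k hx).differentiableAt.differentiableWithinAt
  · intro x hx
    rw [interior_Ici] at hx
    rw [(hasDerivAt_radial m k hx).deriv]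
    exact radialDeriv_nonneg hm k hx

/-- The flux form of the Wronskian of `radial (m + 2) k` and `halfTanh ^ r`. -/
def radialWronskian (m k : ℕ) (r η : ℝ) : ℝ :=
  halfTanh η ^ r * (radialFlux m k η - r * Real.sinh η ^ m * radial (m + 2) k η)

theorem radialWronskian_eq (m k : ℕ) (r : ℝ) {η : ℝ} (hη : 0 < η) :
    radialWronskian m k r η = halfTanh η ^ r * Real.sinh η ^ (m + 1) *
      (radialDeriv m k η - r / Real.sinh η * radial (m + 2) k η) := by
  have hS : Real.sinh η ≠ 0 := (Real.sinh_pos_iff.2 hη).ne'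
  rw [radialWronskian, radialFlux_eq m k hη]
  field_simp
  ring

theorem continuous_radialWronskian (m k : ℕ) {r : ℝ} (hr : 0 ≤ r) :
    Continuous (radialWronskian m k r) := by
  have h1 : Continuous fun x => halfTanh x ^ r :=
    continuous_halfTanh.rpow_const fun x => Or.inr hr
  have h2 := continuous_radialFlux m k
  have h3 := continuous_radial m k
  have h4 := Real.continuous_sinh
  unfold radialWronskian
  fun_prop

theorem radialWronskian_zero {m : ℕ} (hm : 0 < m) (k : ℕ) (r : ℝ) :
    radialWronskian m k r 0 = 0 := by
  simp [radialWronskian, radialFlux_zero hm, hm.ne']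

/-- A power t^r satisfies the radial equation with k(k+m) replaced by r m cosh η + r². The sign of
the difference decides whether t^r grows faster or slower than E. -/
theorem hasDerivAt_radialWronskian {m : ℕ} (hm : 0 < m) (k : ℕ) (r : ℝ) {η : ℝ} (hη : 0 < η) :
    HasDerivAt (radialWronskian m k r)
      (halfTanh η ^ r * Real.sinh η ^ (m - 1) * radial (m + 2) k η
        * (k * ((k : ℝ) + m) - r * m * Real.cosh η - r ^ 2)) η := by
  have hS : Real.sinh η ≠ 0 := (Real.sinh_pos_iff.2 hη).ne'
  have h := (hasDerivAt_halfTanh_rpow r hη).mul ((hasDerivAt_radialFlux hm k hη).sub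
    ((((Real.hasDerivAt_sinh η).pow m).const_mul r).mul (hasDerivAt_radial m k hη)))
  refine h.congr_deriv ?_
  simp only [Pi.sub_apply, Pi.mul_apply, Pi.pow_apply]
  rw [radialFlux_eq m k hη]
  obtain ⟨j, rfl⟩ : ∃ j, m = j + 1 := ⟨m - 1, by omega⟩
  simp only [Nat.add_sub_cancel]
  push_cast
  field_simp
  ring

/-- Comparison with the exponent r = k: as cosh ≥ 1, the Wronskian decreases from 0. -/
theorem radialDeriv_le {m : ℕ} (hm : 0 < m) (k : ℕ) {η : ℝ} (hη : 0 < η) :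
    radialDeriv m k η ≤ k / Real.sinh η * radial (m + 2) k η := by
  have hanti : AntitoneOn (radialWronskian m k k) (Ici 0) := by
    apply antitoneOn_of_deriv_nonpos (convex_Ici 0)
      (continuous_radialWronskian m k (by positivity)).continuousOn
    · intro x hx
      rw [interior_Ici] at hx
      exact (hasDerivAt_radialWronskian hm k k hx).differentiableAt.differentiableWithinAt
    · intro x hx
      rw [interior_Ici] at hx
      rw [(hasDerivAt_radialWronskian hm k k hx).deriv]
      have hS : 0 < Real.sinh x := Real.sinh_pos_iff.2 hx
      have hE := radial_pos hm k hx
      have hT : 0 < halfTanh x := halfTanh_pos hx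
      refine mul_nonpos_of_nonneg_of_nonpos (by positivity) ?_
      have hc := Real.one_le_cosh x
      have : (0 : ℝ) ≤ (k : ℝ) * m * (Real.cosh x - 1) :=
        mul_nonneg (by positivity) (by linarith)
      nlinarith
  have h := hanti (self_mem_Ici (a := (0 : ℝ))) hη.le hη.le
  rw [radialWronskian_zero hm, radialWronskian_eq m k k hη] at h
  have hS : 0 < Real.sinh η := Real.sinh_pos_iff.2 hη
  have hT : 0 < halfTanh η := halfTanh_pos hη
  have hp : 0 < halfTanh η ^ (k : ℝ) * Real.sinh η ^ (m + 1) := by positivity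
  have := nonpos_of_mul_nonpos_right h hp
  linarith

/-- The exponent r = k / cosh R satisfies r m cosh η ≤ k m up to η = R, and r ≤ k, so the Wronskian
increases from 0. Being linear in k, this exponent yields geometric decay. -/
theorem le_radialDeriv {m : ℕ} (hm : 0 < m) (k : ℕ) {η R : ℝ} (hη : 0 < η) (hηR : η ≤ R) :
    k / Real.cosh R / Real.sinh η * radial (m + 2) k η ≤ radialDeriv m k η := by
  set r : ℝ := k / Real.cosh R with hr
  have hc := Real.one_le_cosh R
  have hr0 : 0 ≤ r := by positivity
  have hmono : MonotoneOn (radialWronskian m k r) (Icc 0 R) := by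
    apply monotoneOn_of_deriv_nonneg (convex_Icc 0 R)
      (continuous_radialWronskian m k hr0).continuousOn
    · intro x hx
      rw [interior_Icc] at hx
      exact (hasDerivAt_radialWronskian hm k r hx.1).differentiableAt.differentiableWithinAt
    · intro x hx
      rw [interior_Icc] at hx
      rw [(hasDerivAt_radialWronskian hm k r hx.1).deriv]
      have hS : 0 < Real.sinh x := Real.sinh_pos_iff.2 hx.1
      have hE := radial_pos hm k hx.1
      have hT : 0 < halfTanh x := halfTanh_pos hx.1
      refine mul_nonneg (by positivity) ?_
      have hcx : Real.cosh x ≤ Real.cosh R := by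
        rw [Real.cosh_le_cosh, abs_of_pos hx.1, abs_of_pos (hx.1.trans hx.2)]
        exact hx.2.le
      have h1 : r * Real.cosh R = k := by rw [hr]; field_simp
      have h2 : r ≤ k := by
        rw [hr]; exact div_le_self (by positivity) hc
      have h3 : r * m * Real.cosh x ≤ k * m := by
        calc r * m * Real.cosh x ≤ r * m * Real.cosh R := by gcongr
          _ = k * m := by rw [← h1]; ring
      nlinarith
  have h := hmono (left_mem_Icc.2 (hη.le.trans hηR)) ⟨hη.le, hηR⟩ hη.le
  rw [radialWronskian_zero hm, radialWronskian_eq m k r hη] at h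
  have hS : 0 < Real.sinh η := Real.sinh_pos_iff.2 hη
  have hT : 0 < halfTanh η := halfTanh_pos hη
  have hp : 0 < halfTanh η ^ r * Real.sinh η ^ (m + 1) := by positivity
  have := nonneg_of_mul_nonneg_right h hp
  linarith

/-- The ratios of radial functions decay geometrically in `k`, uniformly in smaller balls. -/
theorem exists_radial_div_le {m : ℕ} (hm : 0 < m) {r R : ℝ} (hr : 0 < r) (hrR : r < R) :
    ∃ ρ : ℝ, 0 ≤ ρ ∧ ρ < 1 ∧ ∀ k : ℕ, ∀ η ∈ Icc 0 r,
      radial (m + 2) k η ≤ ρ ^ k * radial (m + 2) k R := by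
  have hTr := halfTanh_pos hr
  have hTR := halfTanh_pos (hr.trans hrR)
  have hlt := strictMono_halfTanh hrR
  have hc := Real.cosh_pos R
  refine ⟨(halfTanh r / halfTanh R) ^ (1 / Real.cosh R), by positivity, ?_, ?_⟩
  · exact Real.rpow_lt_one (by positivity) ((div_lt_one hTR).2 hlt) (by positivity)
  intro k η hη
  refine (monotoneOn_radial hm k hη.1 hr.le hη.2).trans ?_
  set s : ℝ := k / Real.cosh R with hs
  -- The lower bound on E'/E in integrated form; comparing the ends r and R gives the k-th power of
  -- ρ.
  have hmono : MonotoneOn (fun x => radial (m + 2) k x * halfTanh x ^ (-s)) (Icc r R) := by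
    have hd : ∀ x ∈ Icc r R, HasDerivAt (fun x => radial (m + 2) k x * halfTanh x ^ (-s))
        (halfTanh x ^ (-s) * (radialDeriv m k x - s / Real.sinh x * radial (m + 2) k x)) x := by
      intro x hx
      have hx0 : 0 < x := hr.trans_le hx.1
      refine ((hasDerivAt_radial m k hx0).mul (hasDerivAt_halfTanh_rpow (-s) hx0)).congr_deriv ?_
      ring
    apply monotoneOn_of_deriv_nonneg (convex_Icc r R)
    · exact fun x hx => (hd x hx).continuousAt.continuousWithinAt
    · exact fun x hx => (hd x (interior_subset hx)).differentiableAt.differentiableWithinAt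
    · intro x hx
      have hx' := interior_subset hx
      rw [(hd x hx').deriv]
      have hx0 : 0 < x := hr.trans_le hx'.1
      have := halfTanh_pos hx0
      refine mul_nonneg (by positivity) ?_
      linarith [le_radialDeriv hm k hx0 hx'.2]
  have h := hmono (left_mem_Icc.2 hrR.le) (right_mem_Icc.2 hrR.le) hrR.le
  simp only at h
  have e : ((halfTanh r / halfTanh R) ^ (1 / Real.cosh R)) ^ k
      = halfTanh r ^ s * halfTanh R ^ (-s) := by
    rw [← Real.rpow_natCast, ← Real.rpow_mul (by positivity), Real.rpow_neg hTR.le,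
      ← div_eq_mul_inv, ← Real.div_rpow hTr.le hTR.le, hs]
    congr 1
    ring
  rw [e]
  have h1 : halfTanh r ^ s * halfTanh r ^ (-s) = 1 := by
    rw [← Real.rpow_add hTr]; simp
  have hp : 0 < halfTanh r ^ s := by positivity
  calc radial (m + 2) k r = halfTanh r ^ s * (radial (m + 2) k r * halfTanh r ^ (-s)) := by
        rw [mul_left_comm, h1, mul_one]
    _ ≤ halfTanh r ^ s * (radial (m + 2) k R * halfTanh R ^ (-s)) := by gcongr
    _ = _ := by ring

/-! ### The maximum principle -/

/-- A positive second derivative would make the point a local minimum as well; f would be locally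
constant, with second derivative 0. -/
theorem deriv_deriv_nonpos_of_isLocalMax {f : ℝ → ℝ} {x : ℝ} (h : IsLocalMax f x)
    (hc : ContinuousAt f x) : deriv (deriv f) x ≤ 0 := by
  by_contra! hpos
  have hmin := isLocalMin_of_deriv_deriv_pos hpos h.deriv_eq_zero hc
  have heq : f =ᶠ[𝓝 x] fun _ => f x := by
    filter_upwards [h, hmin] with y h1 h2 using le_antisymm h1 h2
  have h0 := heq.deriv.deriv_eq
  simp at h0
  exact hpos.ne' h0

theorem deriv_le_of_isLocalMax_sub {f b b' : ℝ → ℝ} {x c : ℝ} (hf : ContDiffAt ℝ 2 f x)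
    (hb : ∀ᶠ y in 𝓝 x, HasDerivAt b (b' y) y) (hb' : HasDerivAt b' c x)
    (h : IsLocalMax (fun y => f y - b y) x) :
    deriv f x = b' x ∧ iteratedDeriv 2 f x ≤ c := by
  have hfd : ∀ᶠ y in 𝓝 x, DifferentiableAt ℝ f y := by
    filter_upwards [hf.eventually (by simp)] with y hy using hy.differentiableAt (by simp)
  have hd : deriv (fun y => f y - b y) =ᶠ[𝓝 x] fun y => deriv f y - b' y := by
    filter_upwards [hb, hfd] with y h1 h2 using (h2.hasDerivAt.sub h1).deriv
  have hf2 : DifferentiableAt ℝ (deriv f) x :=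
    (hf.derivWithin (m := 1) one_add_one_eq_two.le).differentiableAt (by simp)
  have h1 := h.deriv_eq_zero
  rw [hd.eq_of_nhds] at h1
  have h2 := deriv_deriv_nonpos_of_isLocalMax h
    (hf.continuousAt.sub hb.self_of_nhds.continuousAt)
  rw [hd.deriv_eq, (hf2.hasDerivAt.fun_sub hb').deriv] at h2
  rw [iteratedDeriv_succ, iteratedDeriv_one]
  exact ⟨by linarith, by linarith⟩

theorem zonalLaplacian_eq (m : ℕ) (h : ℝ → ℝ → ℝ) (η θ : ℝ) :
    zonalLaplacian (m + 2) h η θ = iteratedDeriv 2 (fun s => h s θ) η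
      + ((m : ℝ) + 1) * (Real.cosh η / Real.sinh η) * deriv (fun s => h s θ) η
      + 1 / Real.sinh η ^ 2 * (iteratedDeriv 2 (fun t => h η t) θ
        + m * (Real.cos θ / Real.sin θ) * deriv (fun t => h η t) θ) := by
  rw [zonalLaplacian, Real.tanh_eq_sinh_div_cosh]
  push_cast
  rw [show (m : ℝ) + 2 - 1 = m + 1 by ring, show (m : ℝ) + 2 - 2 = m by ring]
  congr 3
  rw [div_div_eq_mul_div, mul_div_assoc]

theorem contDiffAt_slice_left {v : ℝ → ℝ → ℝ} {η θ : ℝ} {n : WithTop ℕ∞}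
    (h : ContDiffAt ℝ n (Function.uncurry v) (η, θ)) : ContDiffAt ℝ n (fun s => v s θ) η :=
  ContDiffAt.comp (g := Function.uncurry v) (f := fun s : ℝ => (s, θ)) η h
    (contDiffAt_id.prodMk contDiffAt_const)

theorem contDiffAt_slice_right {v : ℝ → ℝ → ℝ} {η θ : ℝ} {n : WithTop ℕ∞}
    (h : ContDiffAt ℝ n (Function.uncurry v) (η, θ)) : ContDiffAt ℝ n (fun t => v η t) θ :=
  ContDiffAt.comp (g := Function.uncurry v) (f := fun t : ℝ => (η, t)) θ h
    (contDiffAt_const.prodMk contDiffAt_id)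

/-- A function that blows up at the centre and at the polar axis. -/
def barrier (η θ : ℝ) : ℝ := -2 * Real.log (halfTanh η) - Real.log (Real.sin θ)

theorem neg_log_halfTanh_nonneg {η : ℝ} (hη : 0 < η) : 0 ≤ -2 * Real.log (halfTanh η) := by
  have h1 := Real.log_nonpos (halfTanh_pos hη).le
    (abs_le.1 ((sq_lt_one_iff_abs_lt_one _).1 (halfTanh_sq_lt_one η)).le).2
  linarith

theorem neg_log_sin_nonneg {θ : ℝ} (hθ : θ ∈ Ioo 0 Real.pi) : 0 ≤ -Real.log (Real.sin θ) := by
  have h1 := Real.log_nonpos (Real.sin_pos_of_mem_Ioo hθ).le (Real.sin_le_one θ)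
  linarith

/-- No point of a ball is a local maximum of a harmonic function minus a multiple of the barrier. -/
theorem not_isLocalMax_sub_barrier {m : ℕ} (hm : 0 < m) {v : ℝ → ℝ → ℝ} {η θ ε : ℝ} (hε : 0 < ε)
    (hη : 0 < η) (hθ : θ ∈ Ioo 0 Real.pi) (hv : ContDiffAt ℝ 2 (Function.uncurry v) (η, θ))
    (hlap : zonalLaplacian (m + 2) v η θ = 0) :
    ¬ IsLocalMax (fun p : ℝ × ℝ => v p.1 p.2 - ε * barrier p.1 p.2) (η, θ) := by
  intro hmax
  have hS : 0 < Real.sinh η := Real.sinh_pos_iff.2 hη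
  have hs := Real.sin_pos_of_mem_Ioo hθ
  have hmax1 : IsLocalMax (fun s => v s θ - ε * barrier s θ) η := by
    have hc : ContinuousAt (fun s : ℝ => (s, θ)) η := by fun_prop
    exact hc.eventually hmax
  have hmax2 : IsLocalMax (fun t => v η t - ε * barrier η t) θ := by
    have hc : ContinuousAt (fun t : ℝ => (η, t)) θ := by fun_prop
    exact hc.eventually hmax
  have hb1 : ∀ᶠ y in 𝓝 η, HasDerivAt (fun s => ε * barrier s θ) (ε * (-2 / Real.sinh y)) y := by
    filter_upwards [lt_mem_nhds hη] with y hy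
    have h1 := halfTanh_pos hy
    have h2 : 1 - halfTanh y ^ 2 ≠ 0 := by linarith [halfTanh_sq_lt_one y]
    have := ((((hasDerivAt_halfTanh y).log h1.ne').const_mul (-2)).sub_const
      (Real.log (Real.sin θ))).const_mul ε
    refine this.congr_deriv ?_
    rw [sinh_eq_halfTanh]
    field_simp
  have hb1' : HasDerivAt (fun y => ε * (-2 / Real.sinh y))
      (ε * (2 * Real.cosh η / Real.sinh η ^ 2)) η := by
    refine (((hasDerivAt_const η (-2 : ℝ)).div (Real.hasDerivAt_sinh η) hS.ne').const_mul
      ε).congr_deriv ?_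
    ring
  have hb2 : ∀ᶠ y in 𝓝 θ, HasDerivAt (fun t => ε * barrier η t)
      (ε * (-(Real.cos y / Real.sin y))) y := by
    filter_upwards [Ioo_mem_nhds hθ.1 hθ.2] with y hy
    have h1 := Real.sin_pos_of_mem_Ioo hy
    have := (((Real.hasDerivAt_sin y).log h1.ne').const_sub
      (-2 * Real.log (halfTanh η))).const_mul ε
    exact this
  have hb2' : HasDerivAt (fun y => ε * (-(Real.cos y / Real.sin y)))
      (ε * (1 / Real.sin θ ^ 2)) θ := by
    refine ((((Real.hasDerivAt_cos θ).div (Real.hasDerivAt_sin θ) hs.ne').neg).const_mul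
      ε).congr_deriv ?_
    have := Real.sin_sq_add_cos_sq θ
    field_simp
    linear_combination this
  obtain ⟨d1, d2⟩ := deriv_le_of_isLocalMax_sub (contDiffAt_slice_left hv) hb1 hb1' hmax1
  obtain ⟨d3, d4⟩ := deriv_le_of_isLocalMax_sub (contDiffAt_slice_right hv) hb2 hb2' hmax2
  rw [zonalLaplacian_eq, d1, d3] at hlap
  have hle : 0 ≤ ε * (2 * Real.cosh η / Real.sinh η ^ 2)
      + ((m : ℝ) + 1) * (Real.cosh η / Real.sinh η) * (ε * (-2 / Real.sinh η))
      + 1 / Real.sinh η ^ 2 * (ε * (1 / Real.sin θ ^ 2)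
        + m * (Real.cos θ / Real.sin θ) * (ε * (-(Real.cos θ / Real.sin θ)))) := by
    rw [← hlap]
    gcongr
  -- The Laplacian of the barrier, which is negative. The coefficient 2 of the radial logarithm
  -- outweighs the -1 from the angular one, using only m ≥ 1 and cosh η ≥ 1.
  have e : ε * (2 * Real.cosh η / Real.sinh η ^ 2)
      + ((m : ℝ) + 1) * (Real.cosh η / Real.sinh η) * (ε * (-2 / Real.sinh η))
      + 1 / Real.sinh η ^ 2 * (ε * (1 / Real.sin θ ^ 2)
        + m * (Real.cos θ / Real.sin θ) * (ε * (-(Real.cos θ / Real.sin θ))))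
      = -(ε / Real.sinh η ^ 2 * (2 * m * Real.cosh η - 1
        + ((m : ℝ) - 1) * (Real.cos θ / Real.sin θ) ^ 2)) := by
    have := Real.sin_sq_add_cos_sq θ
    field_simp
    linear_combination (-1 : ℝ) * this
  rw [e] at hle
  have hm1 : (1 : ℝ) ≤ m := by exact_mod_cast hm
  have hpos : 0 < ε / Real.sinh η ^ 2 * (2 * m * Real.cosh η - 1
        + ((m : ℝ) - 1) * (Real.cos θ / Real.sin θ) ^ 2) := by
    apply mul_pos (by positivity)
    have h1 := Real.one_le_cosh η
    have h2 : 0 ≤ ((m : ℝ) - 1) * (Real.cos θ / Real.sin θ) ^ 2 :=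
      mul_nonneg (by linarith) (sq_nonneg _)
    nlinarith
  linarith

theorem exists_lt_neg_log_halfTanh {η : ℝ} (hη : 0 < η) (L : ℝ) :
    ∃ a ∈ Ioo 0 η, L < -2 * Real.log (halfTanh a) := by
  have h0 : Tendsto halfTanh (𝓝[>] 0) (𝓝[>] 0) := by
    refine tendsto_nhdsWithin_iff.2 ⟨?_, ?_⟩
    · have := continuous_halfTanh.tendsto 0
      rw [halfTanh_zero] at this
      exact this.mono_left nhdsWithin_le_nhds
    · filter_upwards [self_mem_nhdsWithin] with x hx using halfTanh_pos hx
  have h1 := (Real.tendsto_log_nhdsGT_zero.comp h0).const_mul_atBot_of_neg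
    (by norm_num : (-2 : ℝ) < 0)
  obtain ⟨a, ha, ha'⟩ := ((h1.eventually_gt_atTop L).and (Ioo_mem_nhdsGT hη)).exists
  exact ⟨a, ha', ha⟩

theorem exists_lt_neg_log_sin {θ : ℝ} (hθ : 0 < θ) (L : ℝ) :
    ∃ b ∈ Ioo 0 θ, L < -Real.log (Real.sin b) := by
  have h0 : Tendsto Real.sin (𝓝[>] 0) (𝓝[>] 0) := by
    refine tendsto_nhdsWithin_iff.2 ⟨?_, ?_⟩
    · have := Real.continuous_sin.tendsto 0
      rw [Real.sin_zero] at this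
      exact this.mono_left nhdsWithin_le_nhds
    · filter_upwards [Ioo_mem_nhdsGT Real.pi_pos] with x hx using Real.sin_pos_of_mem_Ioo hx
  have h1 := tendsto_neg_atBot_atTop.comp (Real.tendsto_log_nhdsGT_zero.comp h0)
  obtain ⟨a, ha, ha'⟩ := ((h1.eventually_gt_atTop L).and (Ioo_mem_nhdsGT hθ)).exists
  exact ⟨a, ha', ha⟩

/-- Cut off the centre and the axis where ε times the barrier exceeds B - M, with B an upper bound
of v. If the claim failed, the maximum of v minus ε times the barrier over the remaining rectangle
could lie neither on the cuts nor on η = R, and the interior is excluded by superharmonicity. -/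
theorem le_add_barrier_of_boundary_le {m : ℕ} (hm : 0 < m) {R M ε : ℝ} {v : ℝ → ℝ → ℝ}
    (hε : 0 < ε)
    (hd : ContDiffOn ℝ 2 (Function.uncurry v) (Ioo 0 R ×ˢ Ioo 0 Real.pi))
    (hlap : ∀ η ∈ Ioo 0 R, ∀ θ ∈ Ioo 0 Real.pi, zonalLaplacian (m + 2) v η θ = 0)
    (hcont : ContinuousOn (Function.uncurry v) (Icc 0 R ×ˢ Icc 0 Real.pi))
    (hb : ∀ θ ∈ Icc 0 Real.pi, v R θ ≤ M) {η θ : ℝ} (hη : η ∈ Ioo 0 R) (hθ : θ ∈ Ioo 0 Real.pi) :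
    v η θ ≤ M + ε * barrier η θ := by
  by_contra! hgt
  obtain ⟨B, hB⟩ := (isCompact_Icc.prod isCompact_Icc).bddAbove_image hcont
  have hB' : ∀ s ∈ Icc 0 R, ∀ t ∈ Icc 0 Real.pi, v s t ≤ B := fun s hs t ht =>
    hB ⟨(s, t), ⟨hs, ht⟩, rfl⟩
  obtain ⟨a, ha, hLa⟩ := exists_lt_neg_log_halfTanh hη.1 ((B - M) / ε)
  -- The minimum of θ and π - θ keeps the given point inside the symmetric range [b, π - b].
  obtain ⟨b, hbb, hLb⟩ := exists_lt_neg_log_sin (lt_min hθ.1 (sub_pos.2 hθ.2)) ((B - M) / ε)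
  rw [div_lt_iff₀' hε] at hLa hLb
  have hbθ : b < θ := hbb.2.trans_le (min_le_left _ _)
  have hbθ' : θ < Real.pi - b := by linarith [hbb.2.trans_le (min_le_right θ (Real.pi - θ))]
  set K : Set (ℝ × ℝ) := Icc a R ×ˢ Icc b (Real.pi - b) with hK
  have hKsub : K ⊆ Icc 0 R ×ˢ Icc 0 Real.pi :=
    prod_mono (Icc_subset_Icc_left ha.1.le) (Icc_subset_Icc hbb.1.le (by linarith [hbb.1]))
  let w : ℝ × ℝ → ℝ := fun p => v p.1 p.2 - ε * barrier p.1 p.2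
  have hwc : ContinuousOn w K := by
    refine ContinuousOn.sub (hcont.mono hKsub) (continuousOn_const.mul ?_)
    refine ContinuousOn.sub (continuousOn_const.mul (ContinuousOn.log
      (continuous_halfTanh.comp continuous_fst).continuousOn ?_)) (ContinuousOn.log
      (Real.continuous_sin.comp continuous_snd).continuousOn ?_)
    · exact fun p hp => (halfTanh_pos (ha.1.trans_le hp.1.1)).ne'
    · intro p hp
      exact (Real.sin_pos_of_mem_Ioo ⟨hbb.1.trans_le hp.2.1, by linarith [hp.2.2, hbb.1]⟩).ne'
  have hpK : (η, θ) ∈ K := ⟨⟨ha.2.le, hη.2.le⟩, ⟨hbθ.le, hbθ'.le⟩⟩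
  obtain ⟨p, hp, hpmax⟩ := (isCompact_Icc.prod isCompact_Icc).exists_isMaxOn ⟨_, hpK⟩ hwc
  have hwp : M < w p := lt_of_lt_of_le (by simp only [w]; linarith) (hpmax hpK)
  have hp1 : 0 < p.1 := ha.1.trans_le hp.1.1
  have hp2 : p.2 ∈ Ioo 0 Real.pi := ⟨hbb.1.trans_le hp.2.1, by linarith [hp.2.2, hbb.1]⟩
  have hn1 : 0 ≤ ε * (-2 * Real.log (halfTanh p.1)) :=
    mul_nonneg hε.le (neg_log_halfTanh_nonneg hp1)
  have hn2 : 0 ≤ ε * (-Real.log (Real.sin p.2)) := mul_nonneg hε.le (neg_log_sin_nonneg hp2)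
  have hwe : w p = v p.1 p.2 - ε * (-2 * Real.log (halfTanh p.1))
      - ε * (-Real.log (Real.sin p.2)) := by
    simp only [w, barrier]; ring
  have hvB := hB' p.1 (hKsub hp).1 p.2 (hKsub hp).2
  have ne1 : p.1 ≠ a := by
    intro h
    rw [h] at hn1 hwe hvB
    linarith
  have ne2 : p.1 ≠ R := by
    intro h
    have := hb p.2 (hKsub hp).2
    rw [← h] at this
    linarith
  have ne3 : Real.sin p.2 ≠ Real.sin b := by
    intro h
    rw [h] at hn2 hwe
    linarith
  have ne4 : p.2 ≠ b := fun h => ne3 (by rw [h])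
  have ne5 : p.2 ≠ Real.pi - b := fun h => ne3 (by rw [h, Real.sin_pi_sub])
  have hpR : p.1 < R := lt_of_le_of_ne hp.1.2 ne2
  have hnhds : K ∈ 𝓝 p := by
    rw [hK, ← Prod.mk.eta (p := p)]
    exact prod_mem_nhds (Icc_mem_nhds (lt_of_le_of_ne hp.1.1 ne1.symm) hpR)
      (Icc_mem_nhds (lt_of_le_of_ne hp.2.1 ne4.symm) (lt_of_le_of_ne hp.2.2 ne5))
  have hloc : IsLocalMax w p := hpmax.isLocalMax hnhds
  have hat : ContDiffAt ℝ 2 (Function.uncurry v) (p.1, p.2) :=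
    hd.contDiffAt ((isOpen_Ioo.prod isOpen_Ioo).mem_nhds ⟨⟨hp1, hpR⟩, hp2⟩)
  exact not_isLocalMax_sub_barrier hm hε hp1 hp2 hat (hlap p.1 ⟨hp1, hpR⟩ p.2 hp2) hloc

/-- The maximum principle: neither the centre nor the polar axis contributes. -/
theorem le_of_boundary_le {m : ℕ} (hm : 0 < m) {R M : ℝ} (hR : 0 < R) {v : ℝ → ℝ → ℝ}
    (hd : ContDiffOn ℝ 2 (Function.uncurry v) (Ioo 0 R ×ˢ Ioo 0 Real.pi))
    (hlap : ∀ η ∈ Ioo 0 R, ∀ θ ∈ Ioo 0 Real.pi, zonalLaplacian (m + 2) v η θ = 0)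
    (hcont : ContinuousOn (Function.uncurry v) (Icc 0 R ×ˢ Icc 0 Real.pi))
    (hb : ∀ θ ∈ Icc 0 Real.pi, v R θ ≤ M) {η θ : ℝ} (hη : η ∈ Icc 0 R) (hθ : θ ∈ Icc 0 Real.pi) :
    v η θ ≤ M := by
  have hcl : closure (Ioo 0 R ×ˢ Ioo 0 Real.pi) = Icc 0 R ×ˢ Icc 0 Real.pi := by
    rw [closure_prod_eq, closure_Ioo hR.ne, closure_Ioo Real.pi_pos.ne]
  have hinterior : ∀ p ∈ Ioo 0 R ×ˢ Ioo 0 Real.pi, Function.uncurry v p ≤ M := by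
    rintro ⟨s, t⟩ ⟨hs, ht⟩
    have hbn : 0 ≤ barrier s t := by
      have h1 := neg_log_halfTanh_nonneg hs.1
      have h2 := neg_log_sin_nonneg ht
      rw [barrier]
      linarith
    refine le_of_forall_pos_le_add fun δ hδ => ?_
    -- This ε makes the barrier contribute at most δ; the summand 1 is there because the barrier is
    -- only known to be nonnegative.
    have h := le_add_barrier_of_boundary_le hm (ε := δ / (barrier s t + 1)) (by positivity)
      hd hlap hcont hb hs ht
    refine h.trans ?_
    have : δ / (barrier s t + 1) * barrier s t ≤ δ := by
      rw [div_mul_eq_mul_div, div_le_iff₀ (by positivity)]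
      nlinarith
    linarith
  have := le_on_closure (f := Function.uncurry v) (g := fun _ => M) hinterior (by rwa [hcl])
    continuousOn_const (x := (η, θ)) (by rw [hcl]; exact ⟨hη, hθ⟩)
  exact this

/-! ### Series of products of functions of one variable -/

theorem abs_mul_le_of_bounds {x y P Q : ℝ} (hx : |x| ≤ P) (hy : |y| ≤ Q) : |x * y| ≤ P * Q := by
  rw [abs_mul]
  exact mul_le_mul hx hy (abs_nonneg _) ((abs_nonneg _).trans hx)

theorem continuousOn_tsum_mul {p q : ℕ → ℝ → ℝ} {P Q : ℕ → ℝ} {I J : Set ℝ}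
    (hPQ : Summable fun k => P k * Q k)
    (hpc : ∀ k, ContinuousOn (p k) I) (hqc : ∀ k, ContinuousOn (q k) J)
    (hp : ∀ k, ∀ x ∈ I, |p k x| ≤ P k) (hq : ∀ k, ∀ y ∈ J, |q k y| ≤ Q k) :
    ContinuousOn (fun z : ℝ × ℝ => ∑' k, p k z.1 * q k z.2) (I ×ˢ J) := by
  refine continuousOn_tsum (fun k => ?_) hPQ fun k z hz =>
    abs_mul_le_of_bounds (hp k _ hz.1) (hq k _ hz.2)
  exact ((hpc k).comp continuousOn_fst fun z hz => hz.1).mul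
    ((hqc k).comp continuousOn_snd fun z hz => hz.2)

/-- Each factor shares its majorant with its derivative, so both partial derivatives are dominated
by P Q and the full derivative by 2 P Q. -/
theorem hasFDerivAt_tsum_mul {p p' q q' : ℕ → ℝ → ℝ} {P Q : ℕ → ℝ} {I J : Set ℝ}
    (hI : IsOpen I) (hJ : IsOpen J) (hIc : Convex ℝ I) (hJc : Convex ℝ J)
    (hPQ : Summable fun k => P k * Q k)
    (hpd : ∀ k, ∀ x ∈ I, HasDerivAt (p k) (p' k x) x)
    (hqd : ∀ k, ∀ y ∈ J, HasDerivAt (q k) (q' k y) y)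
    (hp : ∀ k, ∀ x ∈ I, |p k x| ≤ P k) (hp' : ∀ k, ∀ x ∈ I, |p' k x| ≤ P k)
    (hq : ∀ k, ∀ y ∈ J, |q k y| ≤ Q k) (hq' : ∀ k, ∀ y ∈ J, |q' k y| ≤ Q k)
    {z : ℝ × ℝ} (hz : z ∈ I ×ˢ J) :
    HasFDerivAt (fun z : ℝ × ℝ => ∑' k, p k z.1 * q k z.2)
      ((∑' k, p' k z.1 * q k z.2) • ContinuousLinearMap.fst ℝ ℝ ℝ
        + (∑' k, p k z.1 * q' k z.2) • ContinuousLinearMap.snd ℝ ℝ ℝ) z := by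
  have h := hasFDerivAt_tsum_of_isPreconnected (𝕜 := ℝ) (s := I ×ˢ J)
    (f := fun k (z : ℝ × ℝ) => p k z.1 * q k z.2)
    (f' := fun k z => (p' k z.1 * q k z.2) • ContinuousLinearMap.fst ℝ ℝ ℝ
        + (p k z.1 * q' k z.2) • ContinuousLinearMap.snd ℝ ℝ ℝ) (x₀ := z) (x := z)
    (hPQ.mul_left 2) (hI.prod hJ) (hIc.prod hJc).isPreconnected ?_ ?_ hz ?_ hz
  · refine h.congr_fderiv ?_
    have s1 : Summable fun k => p' k z.1 * q k z.2 := Summable.of_norm_bounded hPQ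
      fun k => abs_mul_le_of_bounds (hp' k _ hz.1) (hq k _ hz.2)
    have s2 : Summable fun k => p k z.1 * q' k z.2 := Summable.of_norm_bounded hPQ
      fun k => abs_mul_le_of_bounds (hp k _ hz.1) (hq' k _ hz.2)
    exact ((s1.hasSum.smul_const _).add (s2.hasSum.smul_const _)).tsum_eq
  · intro k x hx
    have h1 : HasFDerivAt (fun z : ℝ × ℝ => p k z.1) _ x :=
      (hpd k x.1 hx.1).hasFDerivAt.comp x hasFDerivAt_fst
    have h2 : HasFDerivAt (fun z : ℝ × ℝ => q k z.2) _ x :=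
      (hqd k x.2 hx.2).hasFDerivAt.comp x hasFDerivAt_snd
    refine (h1.mul h2).congr_fderiv ?_
    ext <;> simp [mul_comm]
  · intro k x hx
    refine (norm_add_le _ _).trans ?_
    rw [norm_smul, norm_smul, Real.norm_eq_abs, Real.norm_eq_abs]
    have h1 := abs_mul_le_of_bounds (hp' k _ hx.1) (hq k _ hx.2)
    have h2 := abs_mul_le_of_bounds (hp k _ hx.1) (hq' k _ hx.2)
    have n1 := mul_le_of_le_one_right (abs_nonneg (p' k x.1 * q k x.2))
      (ContinuousLinearMap.norm_fst_le ℝ ℝ ℝ)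
    have n2 := mul_le_of_le_one_right (abs_nonneg (p k x.1 * q' k x.2))
      (ContinuousLinearMap.norm_snd_le ℝ ℝ ℝ)
    linarith
  · exact Summable.of_norm_bounded hPQ
      fun k => abs_mul_le_of_bounds (hp k _ hz.1) (hq k _ hz.2)

theorem contDiffAt_smul_fst_add_smul_snd {n : WithTop ℕ∞} {A B : ℝ × ℝ → ℝ} {z : ℝ × ℝ}
    (hA : ContDiffAt ℝ n A z) (hB : ContDiffAt ℝ n B z) :
    ContDiffAt ℝ n (fun z => A z • ContinuousLinearMap.fst ℝ ℝ ℝ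
      + B z • ContinuousLinearMap.snd ℝ ℝ ℝ) z :=
  (hA.smul contDiffAt_const).add (hB.smul contDiffAt_const)

theorem contDiffAt_one_tsum_mul {p p' q q' : ℕ → ℝ → ℝ} {P Q : ℕ → ℝ} {I J : Set ℝ}
    (hI : IsOpen I) (hJ : IsOpen J) (hIc : Convex ℝ I) (hJc : Convex ℝ J)
    (hPQ : Summable fun k => P k * Q k)
    (hpd : ∀ k, ∀ x ∈ I, HasDerivAt (p k) (p' k x) x)
    (hqd : ∀ k, ∀ y ∈ J, HasDerivAt (q k) (q' k y) y)
    (hpc : ∀ k, ContinuousOn (p' k) I) (hqc : ∀ k, ContinuousOn (q' k) J)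
    (hp : ∀ k, ∀ x ∈ I, |p k x| ≤ P k) (hp' : ∀ k, ∀ x ∈ I, |p' k x| ≤ P k)
    (hq : ∀ k, ∀ y ∈ J, |q k y| ≤ Q k) (hq' : ∀ k, ∀ y ∈ J, |q' k y| ≤ Q k)
    {z : ℝ × ℝ} (hz : z ∈ I ×ˢ J) :
    ContDiffAt ℝ 1 (fun z : ℝ × ℝ => ∑' k, p k z.1 * q k z.2) z := by
  have hU : I ×ˢ J ∈ 𝓝 z := (hI.prod hJ).mem_nhds hz
  rw [← zero_add (1 : WithTop ℕ∞)]
  refine (contDiffAt_succ_iff_hasFDerivAt (n := 0)).2 ⟨_, ⟨I ×ˢ J, hU, fun x hx =>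
    hasFDerivAt_tsum_mul hI hJ hIc hJc hPQ hpd hqd hp hp' hq hq' hx⟩, ?_⟩
  refine contDiffAt_smul_fst_add_smul_snd ?_ ?_
  · exact contDiffAt_zero.2 ⟨I ×ˢ J, hU, continuousOn_tsum_mul hPQ hpc
      (fun k y hy => (hqd k y hy).continuousAt.continuousWithinAt) hp' hq⟩
  · exact contDiffAt_zero.2 ⟨I ×ˢ J, hU, continuousOn_tsum_mul hPQ
      (fun k x hx => (hpd k x hx).continuousAt.continuousWithinAt) hqc hp hq'⟩

/-- Termwise differentiation, up to the second order, of a series of products. -/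
theorem contDiffAt_two_tsum_mul {p p' p'' q q' q'' : ℕ → ℝ → ℝ} {P Q : ℕ → ℝ} {I J : Set ℝ}
    (hI : IsOpen I) (hJ : IsOpen J) (hIc : Convex ℝ I) (hJc : Convex ℝ J)
    (hPQ : Summable fun k => P k * Q k)
    (hpd : ∀ k, ∀ x ∈ I, HasDerivAt (p k) (p' k x) x)
    (hqd : ∀ k, ∀ y ∈ J, HasDerivAt (q k) (q' k y) y)
    (hpd' : ∀ k, ∀ x ∈ I, HasDerivAt (p' k) (p'' k x) x)
    (hqd' : ∀ k, ∀ y ∈ J, HasDerivAt (q' k) (q'' k y) y)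
    (hpc : ∀ k, ContinuousOn (p'' k) I) (hqc : ∀ k, ContinuousOn (q'' k) J)
    (hp : ∀ k, ∀ x ∈ I, |p k x| ≤ P k) (hp' : ∀ k, ∀ x ∈ I, |p' k x| ≤ P k)
    (hp'' : ∀ k, ∀ x ∈ I, |p'' k x| ≤ P k)
    (hq : ∀ k, ∀ y ∈ J, |q k y| ≤ Q k) (hq' : ∀ k, ∀ y ∈ J, |q' k y| ≤ Q k)
    (hq'' : ∀ k, ∀ y ∈ J, |q'' k y| ≤ Q k)
    {x y : ℝ} (hx : x ∈ I) (hy : y ∈ J) :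
    ContDiffAt ℝ 2 (fun z : ℝ × ℝ => ∑' k, p k z.1 * q k z.2) (x, y) ∧
      deriv (fun s => ∑' k, p k s * q k y) x = ∑' k, p' k x * q k y ∧
      iteratedDeriv 2 (fun s => ∑' k, p k s * q k y) x = ∑' k, p'' k x * q k y ∧
      deriv (fun t => ∑' k, p k x * q k t) y = ∑' k, p k x * q' k y ∧
      iteratedDeriv 2 (fun t => ∑' k, p k x * q k t) y = ∑' k, p k x * q'' k y := by
  have cq : ∀ k, ContinuousOn (q' k) J := fun k y hy =>
    (hqd' k y hy).continuousAt.continuousWithinAt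
  have cp : ∀ k, ContinuousOn (p' k) I := fun k x hx =>
    (hpd' k x hx).continuousAt.continuousWithinAt
  have slice1 : ∀ {a a' b b' : ℕ → ℝ → ℝ} {x y : ℝ},
      HasFDerivAt (fun z : ℝ × ℝ => ∑' k, a k z.1 * b k z.2)
        ((∑' k, a' k x * b k y) • ContinuousLinearMap.fst ℝ ℝ ℝ
        + (∑' k, a k x * b' k y) • ContinuousLinearMap.snd ℝ ℝ ℝ) (x, y) →
      HasDerivAt (fun s => ∑' k, a k s * b k y) (∑' k, a' k x * b k y) x := by
    intro a a' b b' x y h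
    have := h.comp_hasDerivAt x ((hasDerivAt_id x).prodMk (hasDerivAt_const x y))
    simpa [Function.comp_def] using this
  have slice2 : ∀ {a a' b b' : ℕ → ℝ → ℝ} {x y : ℝ},
      HasFDerivAt (fun z : ℝ × ℝ => ∑' k, a k z.1 * b k z.2)
        ((∑' k, a' k x * b k y) • ContinuousLinearMap.fst ℝ ℝ ℝ
        + (∑' k, a k x * b' k y) • ContinuousLinearMap.snd ℝ ℝ ℝ) (x, y) →
      HasDerivAt (fun t => ∑' k, a k x * b k t) (∑' k, a k x * b' k y) y := by
    intro a a' b b' x y h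
    have := h.comp_hasDerivAt y ((hasDerivAt_const y x).prodMk (hasDerivAt_id y))
    simpa [Function.comp_def] using this
  have F0 : ∀ x ∈ I, ∀ y ∈ J, _ := fun x hx y hy => hasFDerivAt_tsum_mul (z := (x, y)) hI hJ hIc hJc
    hPQ hpd hqd hp hp' hq hq' ⟨hx, hy⟩
  have F1 : ∀ x ∈ I, ∀ y ∈ J, _ := fun x hx y hy => hasFDerivAt_tsum_mul (z := (x, y)) hI hJ hIc hJc
    hPQ hpd' hqd hp' hp'' hq hq' ⟨hx, hy⟩
  have F2 : ∀ x ∈ I, ∀ y ∈ J, _ := fun x hx y hy => hasFDerivAt_tsum_mul (z := (x, y)) hI hJ hIc hJc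
    hPQ hpd hqd' hp hp' hq' hq'' ⟨hx, hy⟩
  refine ⟨?_, (slice1 (F0 x hx y hy)).deriv, ?_, (slice2 (F0 x hx y hy)).deriv, ?_⟩
  -- Both partial derivatives are again series of products, with one factor replaced by its
  -- derivative, so the first-order result applies to them.
  · rw [← one_add_one_eq_two]
    refine (contDiffAt_succ_iff_hasFDerivAt (n := 1)).2 ⟨_, ⟨I ×ˢ J, (hI.prod hJ).mem_nhds
      ⟨hx, hy⟩, fun z hz => hasFDerivAt_tsum_mul hI hJ hIc hJc hPQ hpd hqd hp hp' hq hq' hz⟩, ?_⟩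
    refine contDiffAt_smul_fst_add_smul_snd ?_ ?_
    · exact contDiffAt_one_tsum_mul hI hJ hIc hJc hPQ hpd' hqd hpc cq hp' hp'' hq hq' ⟨hx, hy⟩
    · exact contDiffAt_one_tsum_mul hI hJ hIc hJc hPQ hpd hqd' cp hqc hp hp' hq' hq'' ⟨hx, hy⟩
  · rw [iteratedDeriv_succ, iteratedDeriv_one]
    have he : deriv (fun s => ∑' k, p k s * q k y) =ᶠ[𝓝 x] fun s => ∑' k, p' k s * q k y := by
      filter_upwards [hI.mem_nhds hx] with s hs using (slice1 (F0 s hs y hy)).deriv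
    rw [he.deriv_eq, (slice1 (F1 x hx y hy)).deriv]
  · rw [iteratedDeriv_succ, iteratedDeriv_one]
    have he : deriv (fun t => ∑' k, p k x * q k t) =ᶠ[𝓝 y] fun t => ∑' k, p k x * q' k t := by
      filter_upwards [hJ.mem_nhds hy] with t ht using (slice2 (F0 x hx t ht)).deriv
    rw [he.deriv_eq, (slice2 (F2 x hx y hy)).deriv]

/-! ### Zonal expansions -/

/-- The sequence `c` grows at most polynomially. -/
def PolyGrowth (c : ℕ → ℝ) : Prop := ∃ K : ℝ, ∃ d : ℕ, ∀ k : ℕ, |c k| ≤ K * ((k : ℝ) + 1) ^ d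

/-- The harmonic function on the ball of radius `R` with the zonal coefficients `c` on the
boundary. -/
def zonalSeries (m : ℕ) (R : ℝ) (c : ℕ → ℝ) (η θ : ℝ) : ℝ :=
  ∑' k : ℕ, c k * (radial (m + 2) k η / radial (m + 2) k R) * zonal m k θ

theorem summable_polynomial_bounds {K L ρ : ℝ} (d e : ℕ) (h0 : 0 ≤ ρ) (h1 : ρ < 1) :
    Summable fun k : ℕ => (K * ((k : ℝ) + 1) ^ d * ρ ^ k) * (L * ((k : ℝ) + 1) ^ e) := by
  refine ((summable_add_one_pow_mul_geometric (d + e) h0 h1).mul_left (K * L)).congr fun k => ?_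
  rw [pow_add]
  ring

theorem exists_radial_bound {m : ℕ} (hm : 0 < m) {c : ℕ → ℝ} (hc : PolyGrowth c) {r R : ℝ}
    (hr : 0 < r) (hrR : r < R) : ∃ K ρ : ℝ, ∃ d : ℕ, 0 ≤ K ∧ 0 ≤ ρ ∧ ρ < 1 ∧ ∀ k : ℕ, ∀ η ∈ Icc 0 r,
      |c k| * (radial (m + 2) k η / radial (m + 2) k R) ≤ K * ((k : ℝ) + 1) ^ d * ρ ^ k := by
  obtain ⟨K, d, hK⟩ := hc
  obtain ⟨ρ, h0, h1, hρ⟩ := exists_radial_div_le hm hr hrR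
  have hK0 : 0 ≤ K := by simpa using (abs_nonneg _).trans (hK 0)
  refine ⟨K, ρ, d, hK0, h0, h1, fun k η hη => ?_⟩
  have hR := radial_pos hm k (hr.trans hrR)
  have h2 : radial (m + 2) k η / radial (m + 2) k R ≤ ρ ^ k :=
    (div_le_iff₀ hR).2 (hρ k η hη)
  exact mul_le_mul (hK k) h2 (div_nonneg (radial_nonneg hm k hη.1) hR.le) (by positivity)

theorem abs_coeff_mul_radial {m : ℕ} (hm : 0 < m) (c : ℕ → ℝ) (k : ℕ) {η R : ℝ} (hη : 0 ≤ η)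
    (hR : 0 < R) : |c k * (radial (m + 2) k η / radial (m + 2) k R)|
      = |c k| * (radial (m + 2) k η / radial (m + 2) k R) := by
  rw [abs_mul, abs_of_nonneg (div_nonneg (radial_nonneg hm k hη) (radial_pos hm k hR).le)]

theorem continuousOn_zonalSeries {m : ℕ} (hm : 0 < m) {R : ℝ} {c : ℕ → ℝ}
    (hc : PolyGrowth c) :
    ContinuousOn (Function.uncurry (zonalSeries m R c)) (Ico 0 R ×ˢ Icc 0 Real.pi) := by
  rintro ⟨η, θ⟩ ⟨hη, hθ⟩
  obtain ⟨r, hηr, hrR⟩ := exists_between hη.2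
  have hr : 0 < r := hη.1.trans_lt hηr
  obtain ⟨K, ρ, d, hK, h0, h1, hb⟩ := exists_radial_bound hm hc hr hrR
  have hcont := continuousOn_tsum_mul (I := Icc 0 r) (J := univ)
    (p := fun k s => c k * (radial (m + 2) k s / radial (m + 2) k R)) (q := fun k t => zonal m k t)
    (summable_polynomial_bounds (K := K) (L := ((m : ℝ) + 1) ^ 3) d (m + 1) h0 h1)
    (fun k => (((continuous_radial m k).div_const _).const_mul (c k)).continuousOn)
    (fun k => (continuous_zonal m k).continuousOn)
    (fun k s hs => by
      rw [abs_coeff_mul_radial hm c k hs.1 (hr.trans hrR)]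
      exact hb k s hs)
    (fun k t _ => abs_zonal_le_pow hm k t)
  have hat : ContinuousWithinAt (Function.uncurry (zonalSeries m R c)) (Icc 0 r ×ˢ univ) (η, θ) :=
    hcont (η, θ) ⟨⟨hη.1, hηr.le⟩, mem_univ _⟩
  refine hat.mono_of_mem_nhdsWithin ?_
  have : (Iio r : Set ℝ) ×ˢ (univ : Set ℝ) ∈ 𝓝 (η, θ) :=
    prod_mem_nhds (Iio_mem_nhds hηr) univ_mem
  filter_upwards [nhdsWithin_le_nhds this, self_mem_nhdsWithin] with z hz hz'
  exact ⟨⟨hz'.1.1, le_of_lt hz.1⟩, mem_univ _⟩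

/-- Termwise differentiation takes place on a < s < r with 0 < a < η < r < R: r < R provides the
geometric decay, and a > 0 keeps the factors 1 / sinh s of the radial derivatives bounded. -/
theorem zonalSeries_differential {m : ℕ} (hm : 0 < m) {R : ℝ} {c : ℕ → ℝ}
    (hc : PolyGrowth c) {η θ : ℝ} (hη : η ∈ Ioo 0 R) (hθ : θ ∈ Ioo 0 Real.pi) :
    ContDiffAt ℝ 2 (Function.uncurry (zonalSeries m R c)) (η, θ) ∧
      zonalLaplacian (m + 2) (zonalSeries m R c) η θ = 0 := by
  obtain ⟨a, ha, haη⟩ := exists_between hη.1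
  obtain ⟨r, hηr, hrR⟩ := exists_between hη.2
  have hr : 0 < r := hη.1.trans hηr
  have hR : 0 < R := hr.trans hrR
  obtain ⟨K, ρ, d, hK, h0, h1, hb⟩ := exists_radial_bound hm hc hr hrR
  set s₀ := Real.sinh a with hs₀
  have hs₀p : 0 < s₀ := Real.sinh_pos_iff.2 ha
  set C := Real.cosh r with hC
  have hCp : 0 < C := Real.cosh_pos r
  -- The summands of L bound E, E' and E'' in turn, each relative to (k + 1)² E.
  set L : ℝ := 1 + 1 / s₀ + (((m : ℝ) + 1) / s₀ ^ 2 + ((m : ℝ) + 1) * (C / s₀) * (1 / s₀)) with hL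
  have t1 : 0 ≤ 1 / s₀ := by positivity
  have t2 : 0 ≤ ((m : ℝ) + 1) / s₀ ^ 2 := by positivity
  have t3 : 0 ≤ ((m : ℝ) + 1) * (C / s₀) * (1 / s₀) := by positivity
  let p : ℕ → ℝ → ℝ := fun k s => c k * (radial (m + 2) k s / radial (m + 2) k R)
  let p' : ℕ → ℝ → ℝ := fun k s => c k * (radialDeriv m k s / radial (m + 2) k R)
  let p'' : ℕ → ℝ → ℝ := fun k s => c k * (radialDerivTwo m k s / radial (m + 2) k R)
  let P : ℕ → ℝ := fun k => K * L * ((k : ℝ) + 1) ^ (d + 2) * ρ ^ k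
  let Q : ℕ → ℝ := fun k => ((m : ℝ) + 1) ^ 3 * ((k : ℝ) + 1) ^ (m + 1)
  have hPQ : Summable fun k => P k * Q k := summable_polynomial_bounds (d + 2) (m + 1) h0 h1
  have hratio : ∀ k, ∀ s ∈ Ioo a r, radialDeriv m k s ≤ k * (1 / s₀) * radial (m + 2) k s := by
    intro k s hs
    have hs0 : 0 < s := ha.trans hs.1
    refine (radialDeriv_le hm k hs0).trans ?_
    have := radial_nonneg hm k hs0.le
    have hsinh : s₀ ≤ Real.sinh s := Real.sinh_le_sinh.2 hs.1.le
    rw [mul_one_div]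
    gcongr
  have key : ∀ (k : ℕ) (s A X : ℝ), s ∈ Ioo a r → |X| ≤ A * radial (m + 2) k s →
      A ≤ L * ((k : ℝ) + 1) ^ 2 → |c k * (X / radial (m + 2) k R)| ≤ P k := by
    intro k s A X hs hX hA
    have hRp := radial_pos hm k hR
    have hs0 : 0 < s := ha.trans hs.1
    have hsp := radial_pos hm k hs0
    have hA0 : 0 ≤ A := by
      by_contra! hneg
      have := (abs_nonneg X).trans hX
      nlinarith
    have hbk := hb k s ⟨hs0.le, hs.2.le⟩
    rw [abs_mul, abs_div, abs_of_pos hRp]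
    calc |c k| * (|X| / radial (m + 2) k R)
        ≤ |c k| * (A * radial (m + 2) k s / radial (m + 2) k R) := by gcongr
      _ = A * (|c k| * (radial (m + 2) k s / radial (m + 2) k R)) := by ring
      _ ≤ (L * ((k : ℝ) + 1) ^ 2) * (K * ((k : ℝ) + 1) ^ d * ρ ^ k) := by
        gcongr
      _ = P k := by simp only [P]; rw [pow_add]; ring
  have hk1 : ∀ k : ℕ, (1 : ℝ) ≤ ((k : ℝ) + 1) ^ 2 := fun k =>
    one_le_pow₀ (by linarith [(by positivity : (0 : ℝ) ≤ k)])
  have hk2 : ∀ k : ℕ, (k : ℝ) ≤ ((k : ℝ) + 1) ^ 2 := fun k => by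
    nlinarith [(by positivity : (0 : ℝ) ≤ k)]
  have hk3 : ∀ k : ℕ, (k : ℝ) * ((k : ℝ) + m) ≤ ((m : ℝ) + 1) * ((k : ℝ) + 1) ^ 2 := fun k => by
    have hk0 : (0 : ℝ) ≤ k := by positivity
    have hm0 : (0 : ℝ) ≤ m := by positivity
    nlinarith [mul_nonneg hk0 hm0, mul_nonneg (mul_nonneg hk0 hk0) hm0]
  have hp : ∀ k, ∀ s ∈ Ioo a r, |p k s| ≤ P k := by
    intro k s hs
    refine key k s 1 _ hs ?_ ?_
    · rw [one_mul, abs_of_nonneg (radial_nonneg hm k (ha.trans hs.1).le)]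
    · have := hk1 k
      nlinarith
  have hp' : ∀ k, ∀ s ∈ Ioo a r, |p' k s| ≤ P k := by
    intro k s hs
    refine key k s (k * (1 / s₀)) _ hs ?_ ?_
    · rw [abs_of_nonneg (radialDeriv_nonneg hm k (ha.trans hs.1))]
      exact hratio k s hs
    · rw [mul_comm]
      have := hk2 k
      gcongr
      linarith
  have hp'' : ∀ k, ∀ s ∈ Ioo a r, |p'' k s| ≤ P k := by
    intro k s hs
    have hs0 : 0 < s := ha.trans hs.1
    have hE := radial_nonneg hm k hs0.le
    have hsinh : s₀ ≤ Real.sinh s := Real.sinh_le_sinh.2 hs.1.le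
    have hS : 0 < Real.sinh s := hs₀p.trans_le hsinh
    have hcosh : Real.cosh s ≤ C := by
      rw [hC, Real.cosh_le_cosh, abs_of_pos hs0, abs_of_pos hr]
      exact hs.2.le
    have hcp := Real.cosh_pos s
    have hd0 := radialDeriv_nonneg hm k hs0
    refine key k s (k * ((k : ℝ) + m) / s₀ ^ 2 + ((m : ℝ) + 1) * (C / s₀) * (k * (1 / s₀))) _ hs
      ?_ ?_
    · rw [radialDerivTwo]
      refine (abs_sub _ _).trans ?_
      rw [abs_of_nonneg (by positivity), abs_of_nonneg (by positivity),
        add_mul (k * ((k : ℝ) + m) / s₀ ^ 2), mul_assoc (((m : ℝ) + 1) * (C / s₀))]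
      have := hratio k s hs
      gcongr
    · have e1 := hk3 k
      have e2 := hk2 k
      calc k * ((k : ℝ) + m) / s₀ ^ 2 + ((m : ℝ) + 1) * (C / s₀) * (k * (1 / s₀))
          ≤ ((m : ℝ) + 1) * ((k : ℝ) + 1) ^ 2 / s₀ ^ 2
            + ((m : ℝ) + 1) * (C / s₀) * (((k : ℝ) + 1) ^ 2 * (1 / s₀)) := by gcongr
        _ = (((m : ℝ) + 1) / s₀ ^ 2 + ((m : ℝ) + 1) * (C / s₀) * (1 / s₀)) * ((k : ℝ) + 1) ^ 2 := by
          ring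
        _ ≤ L * ((k : ℝ) + 1) ^ 2 := by
          gcongr
          linarith
  have hpd : ∀ k, ∀ s ∈ Ioo a r, HasDerivAt (p k) (p' k s) s := fun k s hs =>
    ((hasDerivAt_radial m k (ha.trans hs.1)).div_const _).const_mul (c k)
  have hpd' : ∀ k, ∀ s ∈ Ioo a r, HasDerivAt (p' k) (p'' k s) s := fun k s hs =>
    ((hasDerivAt_radialDeriv m k (ha.trans hs.1)).div_const _).const_mul (c k)
  have hpc : ∀ k, ContinuousOn (p'' k) (Ioo a r) := by
    intro k
    have hne : ∀ s ∈ Ioo a r, Real.sinh s ≠ 0 := fun s hs =>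
      (Real.sinh_pos_iff.2 (ha.trans hs.1)).ne'
    have c1 : ContinuousOn (radialDeriv m k) (Ioo a r) := fun s hs =>
      (hasDerivAt_radialDeriv m k (ha.trans hs.1)).continuousAt.continuousWithinAt
    have c2 := (continuous_radial m k).continuousOn (s := Ioo a r)
    have c3 := Real.continuous_sinh.continuousOn (s := Ioo a r)
    have c4 := Real.continuous_cosh.continuousOn (s := Ioo a r)
    refine continuousOn_const.mul (ContinuousOn.div_const (ContinuousOn.sub ?_ ?_) _)
    · exact (continuousOn_const.div (c3.pow 2) fun s hs => pow_ne_zero 2 (hne s hs)).mul c2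
    · exact (continuousOn_const.mul (c4.div c3 hne)).mul c1
  have hηI : η ∈ Ioo a r := ⟨haη, hηr⟩
  obtain ⟨d0, d1, d2, d3, d4⟩ := contDiffAt_two_tsum_mul (J := univ) isOpen_Ioo isOpen_univ
    (convex_Ioo a r) convex_univ hPQ hpd (fun k t _ => hasDerivAt_zonal m k t) hpd'
    (fun k t _ => hasDerivAt_zonalDeriv m k t) hpc
    (fun k => (continuous_zonalDerivTwo m k).continuousOn) hp hp' hp''
    (fun k t _ => abs_zonal_le_pow hm k t) (fun k t _ => abs_zonalDeriv_le_pow hm k t)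
    (fun k t _ => abs_zonalDerivTwo_le_pow hm k t) hηI (mem_univ θ)
  refine ⟨d0, ?_⟩
  have sm : ∀ {f g : ℕ → ℝ}, (∀ k, |f k| ≤ P k) → (∀ k, |g k| ≤ Q k) →
      Summable fun k => f k * g k := fun hf hg =>
    Summable.of_norm_bounded hPQ fun k => abs_mul_le_of_bounds (hf k) (hg k)
  have s1 := sm (fun k => hp'' k η hηI) (fun k => abs_zonal_le_pow hm k θ)
  have s2 := sm (fun k => hp' k η hηI) (fun k => abs_zonal_le_pow hm k θ)
  have s3 := sm (fun k => hp k η hηI) (fun k => abs_zonalDerivTwo_le_pow hm k θ)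
  have s4 := sm (fun k => hp k η hηI) (fun k => abs_zonalDeriv_le_pow hm k θ)
  rw [zonalLaplacian_eq]
  simp only [zonalSeries]
  simp only [p, p', p''] at d1 d2 d3 d4
  rw [d1, d2, d3, d4]
  have hsum := (s1.hasSum.add
    (s2.hasSum.mul_left (((m : ℝ) + 1) * (Real.cosh η / Real.sinh η)))).add
    ((s3.hasSum.add (s4.hasSum.mul_left (m * (Real.cos θ / Real.sin θ)))).mul_left
      (1 / Real.sinh η ^ 2))
  -- Each summand is harmonic: the radial and the angular eigenvalue cancel.
  have hz : HasSum (fun _ : ℕ => (0 : ℝ)) _ := hsum.congr_fun fun k => by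
    have hz := zonal_ode m k (Real.sin_pos_of_mem_Ioo hθ).ne'
    simp only [p, p', p'', radialDerivTwo]
    linear_combination
      (-(1 / Real.sinh η ^ 2 * (c k * (radial (m + 2) k η / radial (m + 2) k R)))) * hz
  exact hz.unique hasSum_zero

theorem radial_zero_left {m : ℕ} {k : ℕ} (hk : k ≠ 0) : radial (m + 2) k 0 = 0 := by
  rw [radial_eq_halfTanh, halfTanh_zero, zero_pow hk, zero_mul]

theorem isZonalHarmonic_zonalSeries {m : ℕ} (hm : 0 < m) {R : ℝ} {c : ℕ → ℝ}
    (hc : PolyGrowth c) : IsZonalHarmonic (m + 2) R (zonalSeries m R c) where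
  contDiffOn := fun z hz => (zonalSeries_differential hm hc hz.1 hz.2).1.contDiffWithinAt
  laplace := fun _ hη _ hθ => (zonalSeries_differential hm hc hη hθ).2
  continuousOn := continuousOn_zonalSeries hm hc
  center := fun θ _ => by
    have : ∀ t, zonalSeries m R c 0 t = c 0 * (radial (m + 2) 0 0 / radial (m + 2) 0 R) := by
      intro t
      rw [zonalSeries, tsum_eq_single 0 fun k hk => by rw [radial_zero_left hk]; simp]
      rw [zonal_zero_left, mul_one]
    rw [this, this]

/-! ### Linearity and uniqueness -/

theorem IsZonalHarmonic.sub {n : ℕ} {R : ℝ} {v w : ℝ → ℝ → ℝ} (hv : IsZonalHarmonic n R v)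
    (hw : IsZonalHarmonic n R w) : IsZonalHarmonic n R (fun η θ => v η θ - w η θ) where
  contDiffOn := hv.contDiffOn.sub hw.contDiffOn
  laplace := fun η hη θ hθ => by
    have hmem : Ioo 0 R ×ˢ Ioo 0 Real.pi ∈ 𝓝 (η, θ) :=
      (isOpen_Ioo.prod isOpen_Ioo).mem_nhds ⟨hη, hθ⟩
    have v1 := contDiffAt_slice_left (hv.contDiffOn.contDiffAt hmem)
    have v2 := contDiffAt_slice_right (hv.contDiffOn.contDiffAt hmem)
    have w1 := contDiffAt_slice_left (hw.contDiffOn.contDiffAt hmem)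
    have w2 := contDiffAt_slice_right (hw.contDiffOn.contDiffAt hmem)
    have hv0 := hv.laplace η hη θ hθ
    have hw0 := hw.laplace η hη θ hθ
    rw [zonalLaplacian] at hv0 hw0 ⊢
    rw [iteratedDeriv_fun_sub v1 w1, iteratedDeriv_fun_sub v2 w2,
      deriv_fun_sub (v1.differentiableAt (by simp)) (w1.differentiableAt (by simp)),
      deriv_fun_sub (v2.differentiableAt (by simp)) (w2.differentiableAt (by simp))]
    linear_combination hv0 - hw0
  continuousOn := hv.continuousOn.sub hw.continuousOn
  center := fun θ hθ => by rw [hv.center θ hθ, hw.center θ hθ]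

theorem IsZonalHarmonic.mono {n : ℕ} {r R : ℝ} {v : ℝ → ℝ → ℝ} (hv : IsZonalHarmonic n R v)
    (hrR : r ≤ R) : IsZonalHarmonic n r v where
  contDiffOn := hv.contDiffOn.mono (prod_mono (Ioo_subset_Ioo_right hrR) subset_rfl)
  laplace := fun η hη => hv.laplace η (Ioo_subset_Ioo_right hrR hη)
  continuousOn := hv.continuousOn.mono (prod_mono (Ico_subset_Ico_right hrR) subset_rfl)
  center := hv.center

theorem IsZonalHarmonic.congr {n : ℕ} {R : ℝ} (hR : 0 < R) {v w : ℝ → ℝ → ℝ}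
    (hv : IsZonalHarmonic n R v) (h : ∀ η < R, ∀ θ, w η θ = v η θ) : IsZonalHarmonic n R w where
  contDiffOn := hv.contDiffOn.congr fun z hz => h z.1 hz.1.2 z.2
  laplace := fun η hη θ hθ => by
    have h1 : (fun s => w s θ) =ᶠ[𝓝 η] fun s => v s θ := by
      filter_upwards [Iio_mem_nhds hη.2] with s hs using h s hs θ
    have h2 : (fun t => w η t) = fun t => v η t := funext (h η hη.2)
    rw [← hv.laplace η hη θ hθ, zonalLaplacian, zonalLaplacian, h2, h1.deriv_eq,
      h1.iteratedDeriv_eq]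
  continuousOn := hv.continuousOn.congr fun z hz => h z.1 hz.1.2 z.2
  center := fun θ hθ => by rw [h 0 hR, h 0 hR, hv.center θ hθ]

theorem IsDirichletSolution.le_of_le {m : ℕ} (hm : 0 < m) {R : ℝ} (hR : 0 < R) {f g : ℝ → ℝ}
    {v w : ℝ → ℝ → ℝ} {M : ℝ} (hv : IsDirichletSolution (m + 2) R f v)
    (hw : IsDirichletSolution (m + 2) R g w) (hfg : ∀ θ ∈ Icc 0 Real.pi, f θ - g θ ≤ M) {η θ : ℝ}
    (hη : η ∈ Icc 0 R) (hθ : θ ∈ Icc 0 Real.pi) : v η θ - w η θ ≤ M := by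
  have h := hv.harmonic.sub hw.harmonic
  refine le_of_boundary_le hm hR h.contDiffOn h.laplace (hv.continuousOn.sub hw.continuousOn)
    (fun t ht => ?_) hη hθ
  rw [hv.boundary t ht, hw.boundary t ht]
  exact hfg t ht

theorem IsDirichletSolution.eq {m : ℕ} (hm : 0 < m) {R : ℝ} (hR : 0 < R) {g : ℝ → ℝ}
    {v w : ℝ → ℝ → ℝ} (hv : IsDirichletSolution (m + 2) R g v)
    (hw : IsDirichletSolution (m + 2) R g w) {η θ : ℝ} (hη : η ∈ Icc 0 R)
    (hθ : θ ∈ Icc 0 Real.pi) : v η θ = w η θ := by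
  have h1 := hv.le_of_le hm hR hw (M := 0) (fun t _ => by simp) hη hθ
  have h2 := hw.le_of_le hm hR hv (M := 0) (fun t _ => by simp) hη hθ
  linarith

/-! ### Solution for zonal polynomials -/

theorem polyGrowth_finsupp (c : ℕ →₀ ℝ) : PolyGrowth c := by
  refine ⟨∑ j ∈ c.support, |c j|, 0, fun k => ?_⟩
  rw [pow_zero, mul_one]
  by_cases hk : k ∈ c.support
  · exact Finset.single_le_sum (f := fun j => |c j|) (fun j _ => abs_nonneg _) hk
  · rw [Finsupp.notMem_support_iff.1 hk, abs_zero]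
    exact Finset.sum_nonneg fun j _ => abs_nonneg _

theorem zonalSeries_finsupp (m : ℕ) (R : ℝ) (c : ℕ →₀ ℝ) (η θ : ℝ) :
    zonalSeries m R c η θ
      = ∑ k ∈ c.support, c k * (radial (m + 2) k η / radial (m + 2) k R) * zonal m k θ := by
  rw [zonalSeries]
  refine tsum_eq_sum fun k hk => ?_
  rw [Finsupp.notMem_support_iff.1 hk]
  simp

theorem isDirichletSolution_finsupp {m : ℕ} (hm : 0 < m) {R : ℝ} (hR : 0 < R) (c : ℕ →₀ ℝ) :
    IsDirichletSolution (m + 2) R (fun θ => ∑ k ∈ c.support, c k * zonal m k θ)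
      (zonalSeries m R c) where
  harmonic := isZonalHarmonic_zonalSeries hm (polyGrowth_finsupp c)
  continuousOn := by
    have : Function.uncurry (zonalSeries m R c) = fun z : ℝ × ℝ => ∑ k ∈ c.support,
        c k * (radial (m + 2) k z.1 / radial (m + 2) k R) * zonal m k z.2 := by
      ext z
      exact zonalSeries_finsupp m R c z.1 z.2
    rw [this]
    refine Continuous.continuousOn (continuous_finsetSum _ fun k _ => ?_)
    exact (continuous_const.mul (((continuous_radial m k).comp continuous_fst).div_const _)).mul
      ((continuous_zonal m k).comp continuous_snd)
  boundary := fun θ _ => by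
    rw [zonalSeries_finsupp]
    refine Finset.sum_congr rfl fun k _ => ?_
    rw [div_self (radial_pos hm k hR).ne', mul_one]

/-- Comparison from both sides with the solution of the empty expansion. -/
theorem abs_zonalSeries_finsupp_le {m : ℕ} (hm : 0 < m) {R : ℝ} (hR : 0 < R) (c : ℕ →₀ ℝ) {B : ℝ}
    (hB : ∀ θ ∈ Icc 0 Real.pi, |∑ k ∈ c.support, c k * zonal m k θ| ≤ B) {η θ : ℝ}
    (hη : η ∈ Icc 0 R) (hθ : θ ∈ Icc 0 Real.pi) : |zonalSeries m R c η θ| ≤ B := by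
  have h0 := isDirichletSolution_finsupp hm hR (0 : ℕ →₀ ℝ)
  have hc := isDirichletSolution_finsupp hm hR c
  have e : zonalSeries m R (0 : ℕ →₀ ℝ) η θ = 0 := by rw [zonalSeries_finsupp]; simp
  have h1 := hc.le_of_le hm hR h0 (M := B) (fun t ht => by
    simpa using (abs_le.1 (hB t ht)).2) hη hθ
  have h2 := h0.le_of_le hm hR hc (M := B) (fun t ht => by
    have := (abs_le.1 (hB t ht)).1
    simp only [Finsupp.support_zero, Finset.sum_empty]
    linarith) hη hθ
  rw [e] at h1 h2
  exact abs_le.2 ⟨by linarith, by linarith⟩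

/-- Weierstrass approximation in the variable x = cos θ. -/
theorem exists_zonal_sum_near (m : ℕ) (hm : 0 < m) {g : ℝ → ℝ} (hg : ContinuousOn g (Icc 0 Real.pi))
    {δ : ℝ} (hδ : 0 < δ) :
    ∃ c : ℕ →₀ ℝ, ∀ θ ∈ Icc 0 Real.pi, |∑ k ∈ c.support, c k * zonal m k θ - g θ| < δ := by
  have hg' : ContinuousOn (fun x => g (Real.arccos x)) (Icc (-1) 1) :=
    hg.comp Real.continuous_arccos.continuousOn
      fun x _ => ⟨Real.arccos_nonneg x, Real.arccos_le_pi x⟩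
  obtain ⟨p, hp⟩ := exists_polynomial_near_of_continuousOn (-1) 1 _ hg' δ hδ
  obtain ⟨c, hc⟩ := exists_eval_eq_sum_gegenbauer (lam := (m : ℝ) / 2) (by positivity) p
  refine ⟨c, fun θ hθ => ?_⟩
  have := hp (Real.cos θ) (cos_mem_Icc θ)
  rw [Real.arccos_cos hθ.1 hθ.2, hc] at this
  exact this

/-! ### Zonal coefficients -/

/-- The coefficients of a function on `[0, π]` in the orthogonal system of zonal functions. -/
def zonalCoeff (m : ℕ) (g : ℝ → ℝ) (k : ℕ) : ℝ :=
  (∫ θ in (0 : ℝ)..Real.pi, zonal m k θ * (g θ * Real.sin θ ^ m)) / zonalNormSq m k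

theorem intervalIntegrable_zonal_mul (m k : ℕ) {g : ℝ → ℝ} (hg : ContinuousOn g (Icc 0 Real.pi)) :
    IntervalIntegrable (fun θ => zonal m k θ * (g θ * Real.sin θ ^ m)) MeasureTheory.volume 0
      Real.pi := by
  apply ContinuousOn.intervalIntegrable
  rw [uIcc_of_le Real.pi_pos.le]
  exact (continuous_zonal m k).continuousOn.mul
    (hg.mul (Real.continuous_sin.pow m).continuousOn)

theorem zonalCoeff_sub {m : ℕ} {f g : ℝ → ℝ} (hf : ContinuousOn f (Icc 0 Real.pi))
    (hg : ContinuousOn g (Icc 0 Real.pi)) (k : ℕ) :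
    zonalCoeff m (fun θ => f θ - g θ) k = zonalCoeff m f k - zonalCoeff m g k := by
  simp only [zonalCoeff]
  rw [← sub_div, ← intervalIntegral.integral_sub (intervalIntegrable_zonal_mul m k hf)
    (intervalIntegrable_zonal_mul m k hg)]
  congr 2
  ext θ
  ring

theorem zonalCoeff_finsupp {m : ℕ} (hm : 0 < m) (c : ℕ →₀ ℝ) (k : ℕ) :
    zonalCoeff m (fun θ => ∑ j ∈ c.support, c j * zonal m j θ) k = c k := by
  rw [zonalCoeff, div_eq_iff (zonalNormSq_pos hm k).ne']
  have e : ∀ θ, zonal m k θ * ((∑ j ∈ c.support, c j * zonal m j θ) * Real.sin θ ^ m)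
      = ∑ j ∈ c.support, c j * (zonal m k θ * zonal m j θ * Real.sin θ ^ m) := by
    intro θ
    rw [Finset.sum_mul, Finset.mul_sum]
    exact Finset.sum_congr rfl fun j _ => by ring
  simp_rw [e]
  rw [intervalIntegral.integral_finsetSum]
  · simp_rw [intervalIntegral.integral_const_mul]
    by_cases hk : k ∈ c.support
    · rw [Finset.sum_eq_single k]
      · rfl
      · intro j _ hj
        rw [integral_zonal_mul_zonal hj.symm, mul_zero]
      · exact fun h => absurd hk h
    · rw [Finsupp.notMem_support_iff.1 hk, zero_mul]
      refine Finset.sum_eq_zero fun j hj => ?_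
      rw [integral_zonal_mul_zonal (fun h : k = j => hk (h ▸ hj)), mul_zero]
  · intro j _
    have h1 := continuous_zonal m k
    have h2 := continuous_zonal m j
    exact Continuous.intervalIntegrable (by fun_prop) _ _

/-- Since |Z_k| ≤ Z_k(0), the quotient Z_k(0)/‖Z_k‖² controls the coefficient, and by
`zonalNormSq_eq` it is linear in k. The bound is also linear in B, which makes the coefficients
stable under approximation of g. -/
theorem abs_zonalCoeff_le {m : ℕ} (hm : 0 < m) {g : ℝ → ℝ} {B : ℝ} (hB0 : 0 ≤ B)
    (hB : ∀ θ ∈ Icc 0 Real.pi, |g θ| ≤ B) (k : ℕ) :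
    |zonalCoeff m g k|
      ≤ B * (2 * Real.pi / ∫ θ in (0 : ℝ)..Real.pi, Real.sin θ ^ m) * ((k : ℝ) + 1) := by
  set I := ∫ θ in (0 : ℝ)..Real.pi, Real.sin θ ^ m with hI
  have hIp : 0 < I := integral_sin_pow_pos m
  have hN := zonalNormSq_pos hm k
  have hz := zonal_apply_zero_pos hm k
  have hNe := zonalNormSq_eq hm k
  rw [← hI] at hNe
  have hm1 : (1 : ℝ) ≤ m := by exact_mod_cast hm
  have hk0 : (0 : ℝ) ≤ k := by positivity
  have h1 : |∫ θ in (0 : ℝ)..Real.pi, zonal m k θ * (g θ * Real.sin θ ^ m)|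
      ≤ zonal m k 0 * (B * 1) * |Real.pi - 0| := by
    rw [← Real.norm_eq_abs]
    refine intervalIntegral.norm_integral_le_of_norm_le_const fun θ hθ => ?_
    rw [uIoc_of_le Real.pi_pos.le] at hθ
    refine abs_mul_le_of_bounds (abs_zonal_le hm k θ)
      (abs_mul_le_of_bounds (hB θ ⟨hθ.1.le, hθ.2⟩) ?_)
    rw [abs_pow]
    exact pow_le_one₀ (abs_nonneg _) (Real.abs_sin_le_one θ)
  rw [mul_one, sub_zero, abs_of_pos Real.pi_pos] at h1
  rw [zonalCoeff, abs_div, abs_of_pos hN, div_le_iff₀ hN]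
  refine h1.trans ?_
  have h2 : 2 * (k : ℝ) / m + 1 ≤ 2 * ((k : ℝ) + 1) := by
    have : 2 * (k : ℝ) / m ≤ 2 * k := div_le_self (by positivity) hm1
    linarith
  have e : zonal m k 0 = (2 * (k : ℝ) / m + 1) * zonalNormSq m k / I := by
    rw [hNe]; field_simp
  calc zonal m k 0 * B * Real.pi
      = (2 * (k : ℝ) / m + 1) * zonalNormSq m k / I * B * Real.pi := by rw [← e]
    _ ≤ 2 * ((k : ℝ) + 1) * zonalNormSq m k / I * B * Real.pi := by
      have := Real.pi_pos
      gcongr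
    _ = _ := by ring

theorem exists_abs_le_of_continuousOn {g : ℝ → ℝ} (hg : ContinuousOn g (Icc 0 Real.pi)) :
    ∃ B, 0 ≤ B ∧ ∀ θ ∈ Icc 0 Real.pi, |g θ| ≤ B := by
  obtain ⟨B, hB⟩ := isCompact_Icc.exists_bound_of_continuousOn hg
  exact ⟨B, (abs_nonneg _).trans (hB 0 ⟨le_rfl, Real.pi_pos.le⟩), hB⟩

theorem polyGrowth_zonalCoeff {m : ℕ} (hm : 0 < m) {g : ℝ → ℝ}
    (hg : ContinuousOn g (Icc 0 Real.pi)) : PolyGrowth (zonalCoeff m g) := by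
  obtain ⟨B, hB0, hB⟩ := exists_abs_le_of_continuousOn hg
  exact ⟨_, 1, fun k => by rw [pow_one]; exact abs_zonalCoeff_le hm hB0 hB k⟩

theorem summable_zonalSeries_majorant {m : ℕ} (hm : 0 < m) {R : ℝ} {c : ℕ → ℝ} (hc : PolyGrowth c)
    {η : ℝ} (hη : η ∈ Ico 0 R) :
    Summable fun k => |c k| * (radial (m + 2) k η / radial (m + 2) k R) * zonal m k 0 := by
  obtain ⟨r, hηr, hrR⟩ := exists_between hη.2
  have hr : 0 < r := hη.1.trans_lt hηr
  obtain ⟨K, ρ, d, hK, h0, h1, hb⟩ := exists_radial_bound hm hc hr hrR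
  refine Summable.of_norm_bounded (summable_polynomial_bounds (K := K) (L := ((m : ℝ) + 1) ^ 3) d
    (m + 1) h0 h1) fun k => abs_mul_le_of_bounds ?_ (abs_zonal_le_pow hm k 0)
  rw [abs_of_nonneg (mul_nonneg (abs_nonneg _) (div_nonneg (radial_nonneg hm k hη.1)
    (radial_pos hm k (hr.trans hrR)).le))]
  exact hb k η ⟨hη.1, hηr.le⟩

theorem abs_zonalSeries_term_le {m : ℕ} (hm : 0 < m) {R : ℝ} (c : ℕ → ℝ) {η : ℝ}
    (hη : η ∈ Ico 0 R) (θ : ℝ) (k : ℕ) :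
    |c k * (radial (m + 2) k η / radial (m + 2) k R) * zonal m k θ|
      ≤ |c k| * (radial (m + 2) k η / radial (m + 2) k R) * zonal m k 0 :=
  abs_mul_le_of_bounds (abs_coeff_mul_radial hm c k hη.1 (hη.1.trans_lt hη.2)).le
    (abs_zonal_le hm k θ)

theorem summable_zonalSeries {m : ℕ} (hm : 0 < m) {R : ℝ} {c : ℕ → ℝ} (hc : PolyGrowth c)
    {η : ℝ} (hη : η ∈ Ico 0 R) (θ : ℝ) :
    Summable fun k => c k * (radial (m + 2) k η / radial (m + 2) k R) * zonal m k θ :=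
  Summable.of_norm_bounded (summable_zonalSeries_majorant hm hc hη)
    (abs_zonalSeries_term_le hm c hη θ)

theorem zonalSeries_sub {m : ℕ} (hm : 0 < m) {R : ℝ} {c c' : ℕ → ℝ} (hc : PolyGrowth c)
    (hc' : PolyGrowth c') {η : ℝ} (hη : η ∈ Ico 0 R) (θ : ℝ) :
    zonalSeries m R (fun k => c k - c' k) η θ
      = zonalSeries m R c η θ - zonalSeries m R c' η θ := by
  rw [zonalSeries, zonalSeries, zonalSeries,
    ← (summable_zonalSeries hm hc hη θ).tsum_sub (summable_zonalSeries hm hc' hη θ)]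
  exact tsum_congr fun k => by ring

/-- Expansions with small coefficients are pointwise small inside the ball. -/
theorem exists_abs_zonalSeries_le {m : ℕ} (hm : 0 < m) {R : ℝ} {η : ℝ} (hη : η ∈ Ico 0 R) :
    ∃ A, ∀ (c : ℕ → ℝ) (B θ : ℝ), (∀ k : ℕ, |c k| ≤ B * ((k : ℝ) + 1)) →
      |zonalSeries m R c η θ| ≤ B * A := by
  have hpg : PolyGrowth fun k : ℕ => (k : ℝ) + 1 := ⟨1, 1, fun k => by
    rw [abs_of_nonneg (by positivity)]; simp⟩
  have hs := summable_zonalSeries_majorant hm hpg hη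
  refine ⟨∑' k : ℕ, |(k : ℝ) + 1| * (radial (m + 2) k η / radial (m + 2) k R) * zonal m k 0,
    fun c B θ hc => ?_⟩
  rw [zonalSeries, ← Real.norm_eq_abs]
  refine tsum_of_norm_bounded (hs.hasSum.mul_left B) fun k => ?_
  refine (abs_zonalSeries_term_le hm c hη θ k).trans ?_
  have h1 := div_nonneg (radial_nonneg hm k hη.1) (radial_pos hm k (hη.1.trans_lt hη.2)).le
  have h2 := (zonal_apply_zero_pos hm k).le
  rw [abs_of_nonneg (by positivity : (0 : ℝ) ≤ (k : ℝ) + 1), ← mul_assoc, ← mul_assoc]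
  gcongr
  exact hc k

theorem continuousOn_zonal_sum (m : ℕ) (c : ℕ →₀ ℝ) (s : Set ℝ) :
    ContinuousOn (fun θ => ∑ j ∈ c.support, c j * zonal m j θ) s :=
  (continuous_finsetSum _ fun j _ => (continuous_zonal m j).const_mul _).continuousOn

/-- The expansion of a continuous function is bounded by the bound of the function. -/
theorem abs_zonalSeries_zonalCoeff_le {m : ℕ} (hm : 0 < m) {R : ℝ} {g : ℝ → ℝ}
    (hg : ContinuousOn g (Icc 0 Real.pi)) {B : ℝ} (hB : ∀ θ ∈ Icc 0 Real.pi, |g θ| ≤ B) {η θ : ℝ}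
    (hη : η ∈ Ico 0 R) (hθ : θ ∈ Icc 0 Real.pi) :
    |zonalSeries m R (zonalCoeff m g) η θ| ≤ B := by
  obtain ⟨A, hA⟩ := exists_abs_zonalSeries_le hm hη
  set D := 2 * Real.pi / ∫ θ in (0 : ℝ)..Real.pi, Real.sin θ ^ m with hD
  -- A zonal polynomial within δ of g obeys the maximum principle, and its coefficients differ from
  -- those of g by at most δ D (k + 1). At fixed η this costs δ D A, with A independent of δ.
  have key : ∀ δ > 0, |zonalSeries m R (zonalCoeff m g) η θ| ≤ (B + δ) + δ * D * A := by
    intro δ hδ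
    obtain ⟨c, hc⟩ := exists_zonal_sum_near m hm hg hδ
    set f : ℝ → ℝ := fun θ => ∑ j ∈ c.support, c j * zonal m j θ with hf
    have hfc : ContinuousOn f (Icc 0 Real.pi) := continuousOn_zonal_sum m c _
    have h1 : |zonalSeries m R c η θ| ≤ B + δ := by
      refine abs_zonalSeries_finsupp_le hm (hη.1.trans_lt hη.2) c (fun t ht => ?_)
        ⟨hη.1, hη.2.le⟩ hθ
      have h2 := hc t ht
      have h3 := hB t ht
      have h4 := abs_sub_abs_le_abs_sub (f t) (g t)
      simp only [hf] at h4
      linarith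
    have e : zonalSeries m R (fun k => zonalCoeff m f k - zonalCoeff m g k) η θ
        = zonalSeries m R c η θ - zonalSeries m R (zonalCoeff m g) η θ := by
      rw [zonalSeries_sub hm (polyGrowth_zonalCoeff hm hfc) (polyGrowth_zonalCoeff hm hg) hη]
      congr 2
      exact funext (zonalCoeff_finsupp hm c)
    have h2 := hA (fun k => zonalCoeff m f k - zonalCoeff m g k) (δ * D) θ (fun k => by
      rw [← zonalCoeff_sub hfc hg]
      exact abs_zonalCoeff_le hm hδ.le (fun t ht => (hc t ht).le) k)
    rw [e] at h2
    have h3 := abs_sub_abs_le_abs_sub (zonalSeries m R (zonalCoeff m g) η θ) (zonalSeries m R c η θ)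
    rw [abs_sub_comm] at h3
    linarith
  have hlim : Tendsto (fun δ : ℝ => (B + δ) + δ * D * A) (𝓝[>] 0) (𝓝 B) := by
    have : Continuous fun δ : ℝ => (B + δ) + δ * D * A := by fun_prop
    have := this.tendsto 0
    simp only [add_zero, zero_mul] at this
    exact this.mono_left nhdsWithin_le_nhds
  exact ge_of_tendsto hlim (by filter_upwards [self_mem_nhdsWithin] with δ hδ using key δ hδ)

/-! ### The Dirichlet problem -/

/-- The solution of the Dirichlet problem with boundary data `g`. -/
def dirichletExtension (m : ℕ) (R : ℝ) (g : ℝ → ℝ) (η θ : ℝ) : ℝ :=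
  if η < R then zonalSeries m R (zonalCoeff m g) η θ else g θ

/-- Continuity up to the boundary holds because the extension is a uniform limit, on the closed
ball, of the solutions for zonal polynomials. Convergence of the expansion at η = R itself is never
claimed. -/
theorem isDirichletSolution_dirichletExtension {m : ℕ} (hm : 0 < m) {R : ℝ} (hR : 0 < R)
    {g : ℝ → ℝ} (hg : ContinuousOn g (Icc 0 Real.pi)) :
    IsDirichletSolution (m + 2) R g (dirichletExtension m R g) where
  harmonic := (isZonalHarmonic_zonalSeries hm (polyGrowth_zonalCoeff hm hg)).congr hR
    fun η hη θ => if_pos hη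
  boundary := fun θ _ => if_neg (lt_irrefl R)
  continuousOn := by
    refine continuousOn_of_uniform_approx_of_continuousOn fun u hu => ?_
    obtain ⟨ε, hε, hεu⟩ := Metric.mem_uniformity_dist.1 hu
    obtain ⟨c, hc⟩ := exists_zonal_sum_near m hm hg (half_pos hε)
    have hsol := isDirichletSolution_finsupp hm hR c
    refine ⟨Function.uncurry (zonalSeries m R c), hsol.continuousOn, ?_⟩
    rintro ⟨η, θ⟩ ⟨hη, hθ⟩
    apply hεu
    rw [Real.dist_eq]
    simp only [Function.uncurry_apply_pair]
    set f : ℝ → ℝ := fun θ => ∑ j ∈ c.support, c j * zonal m j θ with hf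
    have hfc : ContinuousOn f (Icc 0 Real.pi) := continuousOn_zonal_sum m c _
    rcases hη.2.lt_or_eq with hlt | rfl
    · rw [dirichletExtension, if_pos hlt]
      have h := abs_zonalSeries_zonalCoeff_le hm (g := fun t => f t - g t) (hfc.sub hg)
        (fun t ht => (hc t ht).le) ⟨hη.1, hlt⟩ hθ
      rw [show zonalCoeff m (fun t => f t - g t) = fun k => zonalCoeff m f k - zonalCoeff m g k from
        funext (zonalCoeff_sub hfc hg), zonalSeries_sub hm (polyGrowth_zonalCoeff hm hfc)
        (polyGrowth_zonalCoeff hm hg) ⟨hη.1, hlt⟩,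
        show zonalCoeff m f = c from funext (zonalCoeff_finsupp hm c)] at h
      rw [abs_sub_comm]
      linarith
    · rw [dirichletExtension, if_neg (lt_irrefl η), hsol.boundary θ hθ, abs_sub_comm]
      linarith [hc θ hθ]

/-- Termwise integration of an expansion. -/
theorem hasSum_integral_zonalSeries_mul {m : ℕ} (hm : 0 < m) {R : ℝ} {c : ℕ → ℝ}
    (hc : PolyGrowth c) {η : ℝ} (hη : η ∈ Ico 0 R) {ψ : ℝ → ℝ}
    (hψ : ContinuousOn ψ (Icc 0 Real.pi)) :
    HasSum (fun k => c k * (radial (m + 2) k η / radial (m + 2) k R)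
        * ∫ θ in (0 : ℝ)..Real.pi, zonal m k θ * ψ θ)
      (∫ θ in (0 : ℝ)..Real.pi, zonalSeries m R c η θ * ψ θ) := by
  obtain ⟨B, hB0, hB⟩ := exists_abs_le_of_continuousOn hψ
  have hs := (summable_zonalSeries_majorant hm hc hη).mul_right B
  have hsub : uIoc 0 Real.pi ⊆ Icc 0 Real.pi := by
    rw [uIoc_of_le Real.pi_pos.le]; exact Ioc_subset_Icc_self
  have h := intervalIntegral.hasSum_integral_of_dominated_convergence (a := 0) (b := Real.pi)
    (μ := MeasureTheory.volume)
    (F := fun k θ => c k * (radial (m + 2) k η / radial (m + 2) k R) * zonal m k θ * ψ θ)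
    (f := fun θ => zonalSeries m R c η θ * ψ θ)
    (fun k _ => |c k| * (radial (m + 2) k η / radial (m + 2) k R) * zonal m k 0 * B)
    (fun k => ?_) (fun k => Eventually.of_forall fun θ hθ => ?_)
    (Eventually.of_forall fun θ _ => hs) intervalIntegrable_const
    (Eventually.of_forall fun θ _ => (summable_zonalSeries hm hc hη θ).hasSum.mul_right (ψ θ))
  · refine h.congr_fun fun k => ?_
    rw [← intervalIntegral.integral_const_mul]
    simp only [mul_assoc]
  · refine ContinuousOn.aestronglyMeasurable ?_ measurableSet_uIoc
    exact (continuous_const.mul (continuous_zonal m k)).continuousOn.mul (hψ.mono hsub)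
  · exact abs_mul_le_of_bounds (abs_zonalSeries_term_le hm c hη θ k) (hB θ (hsub hθ))

theorem integral_zonalSeries_mul_zonal {m : ℕ} (hm : 0 < m) {R : ℝ} {c : ℕ → ℝ}
    (hc : PolyGrowth c) {η : ℝ} (hη : η ∈ Ico 0 R) (j : ℕ) :
    ∫ θ in (0 : ℝ)..Real.pi, zonalSeries m R c η θ * (zonal m j θ * Real.sin θ ^ m)
      = c j * (radial (m + 2) j η / radial (m + 2) j R) * zonalNormSq m j := by
  have h := hasSum_integral_zonalSeries_mul hm hc hη (ψ := fun θ => zonal m j θ * Real.sin θ ^ m)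
    ((continuous_zonal m j).mul (Real.continuous_sin.pow m)).continuousOn
  refine h.unique ?_
  simp_rw [← mul_assoc (zonal m _ _)]
  refine hasSum_single j fun k hk => ?_
  rw [integral_zonal_mul_zonal hk, mul_zero]

/-! ### The kernel -/

/-- The zonal coefficients of the kernel. -/
def kernelCoeff (m k : ℕ) : ℝ :=
  surfaceArea (((m + 2 : ℕ) : ℝ) - 1) / surfaceArea (m + 2 : ℕ) * (2 * (k : ℝ) / m + 1)

/-- The kernel coefficients are the zonal coefficients of the delta at θ = 0. -/
theorem kernelCoeff_mul_zonalNormSq {m : ℕ} (hm : 0 < m) (k : ℕ) :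
    kernelCoeff m k * zonalNormSq m k = zonal m k 0 := by
  rw [kernelCoeff, mul_assoc, zonalNormSq_eq hm k, mul_left_comm,
    surfaceArea_div_mul_integral_sin_pow, mul_one]

theorem polyGrowth_mul_two_mul_div_add_one {m : ℕ} (hm : 0 < m) (a : ℝ) :
    PolyGrowth fun k : ℕ => a * (2 * (k : ℝ) / m + 1) := by
  refine ⟨|a| * 2, 1, fun k => ?_⟩
  have hm1 : (1 : ℝ) ≤ m := by exact_mod_cast hm
  rw [abs_mul, abs_of_nonneg (by positivity : (0 : ℝ) ≤ 2 * (k : ℝ) / m + 1), mul_assoc, pow_one]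
  have : 2 * (k : ℝ) / m ≤ 2 * k := div_le_self (by positivity) hm1
  gcongr
  linarith

theorem polyGrowth_kernelCoeff {m : ℕ} (hm : 0 < m) : PolyGrowth (kernelCoeff m) :=
  polyGrowth_mul_two_mul_div_add_one hm _

theorem kernelTerm_eq (m : ℕ) (R η θ : ℝ) (k : ℕ) :
    kernelTerm (m + 2) R η θ k = 1 * (2 * (k : ℝ) / m + 1)
      * (radial (m + 2) k η / radial (m + 2) k R) * zonal m k θ * Real.sin θ ^ m := by
  simp [kernelTerm, zonal]

theorem kernel_eq (m : ℕ) (R η θ : ℝ) :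
    kernel (m + 2) R η θ = zonalSeries m R (kernelCoeff m) η θ * Real.sin θ ^ m := by
  rw [kernel, zonalSeries, ← tsum_mul_left, ← tsum_mul_right]
  refine tsum_congr fun k => ?_
  rw [kernelTerm_eq, kernelCoeff]
  ring

/-- Integrated termwise, the kernel coefficient Z_k(0)/‖Z_k‖² meets the integral of Z_k g sin^m,
which leaves the coefficient of g times Z_k(0): the expansion of g evaluated on the axis. -/
theorem integral_kernel_mul {m : ℕ} (hm : 0 < m) {R : ℝ} {g : ℝ → ℝ}
    (hg : ContinuousOn g (Icc 0 Real.pi)) {η : ℝ} (hη : η ∈ Ico 0 R) :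
    ∫ θ in (0 : ℝ)..Real.pi, kernel (m + 2) R η θ * g θ
      = zonalSeries m R (zonalCoeff m g) η 0 := by
  have h := hasSum_integral_zonalSeries_mul hm (polyGrowth_kernelCoeff hm) hη
    (ψ := fun θ => g θ * Real.sin θ ^ m) (hg.mul (Real.continuous_sin.pow m).continuousOn)
  have e : ∀ θ, kernel (m + 2) R η θ * g θ
      = zonalSeries m R (kernelCoeff m) η θ * (g θ * Real.sin θ ^ m) := fun θ => by
    rw [kernel_eq]; ring
  simp_rw [e]
  rw [← h.tsum_eq, zonalSeries]
  refine tsum_congr fun k => ?_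
  have hN := (zonalNormSq_pos hm k).ne'
  rw [← kernelCoeff_mul_zonalNormSq hm k, zonalCoeff]
  field_simp

/-- The integral against φ is the value on the axis of the Dirichlet solution for φ, so the weak
limit is its continuity at the boundary point θ = 0. -/
theorem isDeltaSolution_kernel {m : ℕ} (hm : 0 < m) {R : ℝ} (hR : 0 < R) :
    IsDeltaSolution (m + 2) R (kernel (m + 2) R) := by
  refine ⟨⟨_, isZonalHarmonic_zonalSeries hm (polyGrowth_kernelCoeff hm),
    fun η _ θ _ => kernel_eq m R η θ⟩, fun φ hφ => ?_⟩
  have hsol := isDirichletSolution_dirichletExtension hm hR hφ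
  have h0 : (0 : ℝ) ∈ Icc 0 Real.pi := ⟨le_rfl, Real.pi_pos.le⟩
  have hc : ContinuousWithinAt (fun η => dirichletExtension m R φ η 0) (Icc 0 R) R :=
    ContinuousWithinAt.comp (g := Function.uncurry (dirichletExtension m R φ))
      (f := fun η : ℝ => (η, (0 : ℝ))) (t := Icc 0 R ×ˢ Icc 0 Real.pi)
      (hsol.continuousOn (R, 0) ⟨right_mem_Icc.2 hR.le, h0⟩)
      (by fun_prop) fun η hη => ⟨hη, h0⟩
  have hIco : ∀ᶠ η in 𝓝[<] R, η ∈ Ico 0 R := by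
    filter_upwards [Ioo_mem_nhdsLT hR] with η hη using ⟨hη.1.le, hη.2⟩
  have ht : Tendsto (fun η => dirichletExtension m R φ η 0) (𝓝[<] R) (𝓝 (φ 0)) := by
    have := hc.tendsto
    rw [hsol.boundary 0 h0] at this
    refine this.mono_left ?_
    rw [nhdsWithin_le_iff]
    filter_upwards [hIco] with η hη using ⟨hη.1, hη.2.le⟩
  refine ht.congr' ?_
  filter_upwards [hIco] with η hη
  rw [integral_kernel_mul hm hφ hη, dirichletExtension, if_pos hη.2]

/-- A zonal harmonic function is the Dirichlet extension of its values on a smaller sphere. -/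
theorem IsZonalHarmonic.eq_zonalSeries {m : ℕ} (hm : 0 < m) {R : ℝ} {d : ℝ → ℝ → ℝ}
    (hd : IsZonalHarmonic (m + 2) R d) {η r : ℝ} (hη : 0 ≤ η) (hηr : η < r) (hrR : r < R)
    {θ : ℝ} (hθ : θ ∈ Icc 0 Real.pi) :
    d η θ = zonalSeries m r (zonalCoeff m (d r)) η θ := by
  have hr : 0 < r := hη.trans_lt hηr
  have hcd : ContinuousOn (d r) (Icc 0 Real.pi) :=
    hd.continuousOn.comp (f := fun t : ℝ => (r, t)) (by fun_prop) fun t ht => ⟨⟨hr.le, hrR⟩, ht⟩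
  have hsol : IsDirichletSolution (m + 2) r (d r) d :=
    ⟨hd.mono hrR.le, hd.continuousOn.mono (prod_mono (fun s hs => ⟨hs.1, hs.2.trans_lt hrR⟩)
      subset_rfl), fun _ _ => rfl⟩
  rw [hsol.eq hm hr (isDirichletSolution_dirichletExtension hm hr hcd) ⟨hη, hηr.le⟩ hθ,
    dirichletExtension, if_pos hηr]

/-- A zonal harmonic function with vanishing weak boundary values is zero. -/
theorem IsZonalHarmonic.eq_zero {m : ℕ} (hm : 0 < m) {R : ℝ} {d : ℝ → ℝ → ℝ}
    (hd : IsZonalHarmonic (m + 2) R d)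
    (hlim : ∀ k : ℕ, Tendsto (fun η => ∫ θ in (0 : ℝ)..Real.pi,
      d η θ * (zonal m k θ * Real.sin θ ^ m)) (𝓝[<] R) (𝓝 0)) {η θ : ℝ} (hη : η ∈ Ico 0 R)
    (hθ : θ ∈ Icc 0 Real.pi) : d η θ = 0 := by
  let a : ℕ → ℝ → ℝ := fun k s => ∫ t in (0 : ℝ)..Real.pi,
    d s t * (zonal m k t * Real.sin t ^ m)
  have hcoeff : ∀ k s, zonalCoeff m (d s) k = a k s / zonalNormSq m k := by
    intro k s
    simp only [zonalCoeff, a]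
    congr 2
    ext t
    ring
  have hcont : ∀ s ∈ Ico 0 R, ContinuousOn (d s) (Icc 0 Real.pi) := fun s hs =>
    hd.continuousOn.comp (f := fun t : ℝ => (s, t)) (by fun_prop) fun t ht => ⟨hs, ht⟩
  -- Expanding d from the sphere of radius r shows that its k-th moment on smaller spheres is
  -- proportional to E_k. Letting r ↑ R, the weak limit 0 and E_k(R) > 0 force the moment to vanish.
  have hscale : ∀ k, ∀ s r, 0 ≤ s → s < r → r < R →
      a k s * radial (m + 2) k r = a k r * radial (m + 2) k s := by
    intro k s r hs hsr hrR
    have hr : 0 < r := hs.trans_lt hsr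
    have h1 : a k s = ∫ t in (0 : ℝ)..Real.pi,
        zonalSeries m r (zonalCoeff m (d r)) s t * (zonal m k t * Real.sin t ^ m) := by
      refine intervalIntegral.integral_congr fun t ht => ?_
      rw [uIcc_of_le Real.pi_pos.le] at ht
      rw [hd.eq_zonalSeries hm hs hsr hrR ht]
    rw [h1, integral_zonalSeries_mul_zonal hm (polyGrowth_zonalCoeff hm (hcont r ⟨hr.le, hrR⟩))
      ⟨hs, hsr⟩, hcoeff]
    have hN := (zonalNormSq_pos hm k).ne'
    have hE := (radial_pos hm k hr).ne'
    field_simp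
  have hzero : ∀ k, ∀ s ∈ Ico 0 R, a k s = 0 := by
    intro k s hs
    have hR : 0 < R := hs.1.trans_lt hs.2
    have t1 : Tendsto (fun r => a k s * radial (m + 2) k r) (𝓝[<] R)
        (𝓝 (a k s * radial (m + 2) k R)) :=
      (((continuous_radial m k).tendsto R).mono_left nhdsWithin_le_nhds).const_mul _
    have t2 : Tendsto (fun r => a k r * radial (m + 2) k s) (𝓝[<] R)
        (𝓝 (0 * radial (m + 2) k s)) := (hlim k).mul_const _
    have he : (fun r => a k s * radial (m + 2) k r)
        =ᶠ[𝓝[<] R] fun r => a k r * radial (m + 2) k s := by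
      filter_upwards [Ioo_mem_nhdsLT hs.2] with r hr using hscale k s r hs.1 hr.1 hr.2
    have := tendsto_nhds_unique (t1.congr' he) t2
    rw [zero_mul] at this
    exact (mul_eq_zero.1 this).resolve_right (radial_pos hm k hR).ne'
  obtain ⟨r, hηr, hrR⟩ := exists_between hη.2
  rw [hd.eq_zonalSeries hm hη.1 hηr hrR hθ, zonalSeries]
  have h0 : ∀ k, zonalCoeff m (d r) k = 0 := fun k => by
    rw [hcoeff, hzero k r ⟨(hη.1.trans_lt hηr).le, hrR⟩, zero_div]
  simp [h0]

/-- The weight is divided out first: the difference of the two harmonic factors has weak boundary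
value 0, and testing against the Z_k is enough. -/
theorem IsDeltaSolution.eq_kernel {m : ℕ} (hm : 0 < m) {R : ℝ} (hR : 0 < R) {u : ℝ → ℝ → ℝ}
    (hu : IsDeltaSolution (m + 2) R u) {η θ : ℝ} (hη : η ∈ Ico 0 R) (hθ : θ ∈ Icc 0 Real.pi) :
    u η θ = kernel (m + 2) R η θ := by
  obtain ⟨⟨h, hh, hue⟩, hulim⟩ := hu
  have hk := (isDeltaSolution_kernel hm hR).2
  have hh0 := isZonalHarmonic_zonalSeries hm (R := R) (polyGrowth_kernelCoeff hm)
  have hslice : ∀ {v : ℝ → ℝ → ℝ}, IsZonalHarmonic (m + 2) R v → ∀ s ∈ Ico 0 R, ∀ k,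
      IntervalIntegrable (fun t => v s t * (zonal m k t * Real.sin t ^ m)) MeasureTheory.volume 0
        Real.pi := by
    intro v hv s hs k
    apply ContinuousOn.intervalIntegrable
    rw [uIcc_of_le Real.pi_pos.le]
    have : ContinuousOn (v s) (Icc 0 Real.pi) :=
      hv.continuousOn.comp (f := fun t : ℝ => (s, t)) (by fun_prop) fun t ht => ⟨hs, ht⟩
    exact this.mul ((continuous_zonal m k).mul (Real.continuous_sin.pow m)).continuousOn
  have hzero := (hh.sub hh0).eq_zero hm (fun k => ?_) hη hθ
  · rw [kernel_eq, hue η hη θ hθ]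
    simp only [Nat.add_sub_cancel]
    rw [sub_eq_zero.1 hzero]
  · have hc := (continuous_zonal m k).continuousOn (s := Icc 0 Real.pi)
    have ht := (hulim _ hc).sub (hk _ hc)
    rw [sub_self] at ht
    refine ht.congr' ?_
    filter_upwards [Ioo_mem_nhdsLT hR] with s hs
    have hs' : s ∈ Ico 0 R := ⟨hs.1.le, hs.2⟩
    have e1 : ∫ t in (0 : ℝ)..Real.pi, u s t * zonal m k t
        = ∫ t in (0 : ℝ)..Real.pi, h s t * (zonal m k t * Real.sin t ^ m) := by
      refine intervalIntegral.integral_congr fun t ht => ?_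
      rw [uIcc_of_le Real.pi_pos.le] at ht
      rw [hue s hs' t ht, Nat.add_sub_cancel]
      ring
    have e2 : ∫ t in (0 : ℝ)..Real.pi, kernel (m + 2) R s t * zonal m k t
        = ∫ t in (0 : ℝ)..Real.pi, zonalSeries m R (kernelCoeff m) s t
          * (zonal m k t * Real.sin t ^ m) := by
      refine intervalIntegral.integral_congr fun t _ => ?_
      rw [kernel_eq]
      ring
    rw [e1, e2, ← intervalIntegral.integral_sub (hslice hh s hs' k) (hslice hh0 s hs' k)]
    congr 1
    ext t
    ring

theorem summable_kernelTerm {m : ℕ} (hm : 0 < m) {R η : ℝ} (hη : η ∈ Ico 0 R) (θ : ℝ) :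
    Summable (kernelTerm (m + 2) R η θ) := by
  rw [funext (kernelTerm_eq m R η θ)]
  exact (summable_zonalSeries hm (polyGrowth_mul_two_mul_div_add_one hm 1) hη θ).mul_right _

end HypBall

end

theorem theorem3 (n : ℕ) (hn : 2 < n) (R : ℝ) (hR : 0 < R) :
    -- the series is meaningful: no denominator vanishes, and it converges absolutely
    (∀ k : ℕ, HypBall.radial n k R ≠ 0) ∧
    (∀ η ∈ Set.Ico 0 R, ∀ θ : ℝ, Summable (HypBall.kernelTerm n R η θ)) ∧
    -- it is the solution of the Dirichlet problem with delta boundary data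
    HypBall.IsDeltaSolution n R (HypBall.kernel n R) ∧
    (∀ u : ℝ → ℝ → ℝ, HypBall.IsDeltaSolution n R u →
      ∀ η ∈ Set.Ico 0 R, ∀ θ ∈ Set.Icc 0 Real.pi, u η θ = HypBall.kernel n R η θ) ∧
    -- it is the Poisson kernel of the ball: the angular density, seen from a point of the polar
    -- axis at distance `η` from the centre, that represents the solution for each continuous datum
    (∀ g : ℝ → ℝ, ContinuousOn g (Set.Icc 0 Real.pi) →
      (∃ v : ℝ → ℝ → ℝ, HypBall.IsDirichletSolution n R g v ∧
        ∀ v' : ℝ → ℝ → ℝ, HypBall.IsDirichletSolution n R g v' →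
          ∀ η ∈ Set.Icc 0 R, ∀ θ ∈ Set.Icc 0 Real.pi, v' η θ = v η θ) ∧
      ∀ v : ℝ → ℝ → ℝ, HypBall.IsDirichletSolution n R g v →
        ∀ η ∈ Set.Ico 0 R,
          v η 0 = ∫ θ in (0 : ℝ)..Real.pi, HypBall.kernel n R η θ * g θ) := by
  -- With n = m + 2 the natural-number exponent n - 2 is m and the Gegenbauer parameter is m/2.
  obtain ⟨m, rfl⟩ : ∃ m, n = m + 2 := ⟨n - 2, by omega⟩
  have hm : 0 < m := by omega
  refine ⟨fun k => (HypBall.radial_pos hm k hR).ne',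
    fun η hη θ => HypBall.summable_kernelTerm hm hη θ, HypBall.isDeltaSolution_kernel hm hR,
    fun u hu η hη θ hθ => hu.eq_kernel hm hR hη hθ, fun g hg => ?_⟩
  have hsol := HypBall.isDirichletSolution_dirichletExtension hm hR hg
  refine ⟨⟨_, hsol, fun v' hv' η hη θ hθ => hv'.eq hm hR hsol hη hθ⟩, fun v hv η hη => ?_⟩
  rw [hv.eq hm hR hsol ⟨hη.1, hη.2.le⟩ ⟨le_rfl, Real.pi_pos.le⟩,
    HypBall.integral_kernel_mul hm hg hη,
    HypBall.dirichletExtension, if_pos hη.2]
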